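/- Let $U$ be a smooth manifold (without boundary) and let $\lambda$ be a smooth one-form on $U$ such that $d\lambda$ is nondegenerate; such a pair $(U,\lambda)$ is called an exact symplectic manifold. Its Liouville vector field $\mathcal{L}$ is determined by $d\lambda(\mathcal{L},\cdot)=\lambda$. Call $(U,\lambda)$ an open Liouville domain if for every $t\le 0$ the time-$t$ flow $\mathcal{L}^t\colon U\to U$ of $\mathcal{L}$ exists on all of $U$, and for every $t<0$ the image $\mathcal{L}^t(U)$ has compact closure in $U$. Proposition 2.4. Every open Liouville domain $(U,\lambda)$ is tamely exhausted. That is, for every compact subset $K\subset U$ there is a closed subset $X\subset U$ with $K\subset X$ such that (i) $(X,\lambda|_X)$ is a Liouville domain: $X$ is compact, it is an embedded submanifold with (possibly empty) boundary of $U$ of codimension zero, and $\mathcal{L}$ points outward along $\partial X$; and (ii) $X$ is a deformation retract of $U$: there is a homotopy $H\colon[0,1]\times U\to U$ with $H(0,x)=x$ and $H(1,x)\in X$ for all $x\in U$, and $H(s,x)=x$ for all $s\in[0,1]$ and $x\in X$. -/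

import Mathlib

open scoped Manifold ContDiff

noncomputable section

namespace Liouville

variable {E : Type*} [NormedAddCommGroup E] [NormedSpace ℝ E]
  {M : Type*} [TopologicalSpace M] [ChartedSpace E M]

/-- Smooth (`C^∞`) differential one-forms on the boundaryless manifold `M`: smooth sections of the
cotangent bundle `Hom(TM, ℝ)`. -/
abbrev OneForm (E : Type*) [NormedAddCommGroup E] [NormedSpace ℝ E]
    (M : Type*) [TopologicalSpace M] [ChartedSpace E M] [IsManifold 𝓘(ℝ, E) ∞ M] : Type _ :=
  ContMDiffSection 𝓘(ℝ, E) (E →L[ℝ] ℝ) ∞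
    (fun x : M => TangentSpace 𝓘(ℝ, E) x →L[ℝ] Bundle.Trivial M ℝ x)

variable [IsManifold 𝓘(ℝ, E) ∞ M]

/-- The covector `lam x` as a continuous linear functional on the tangent space at `x`. -/
def OneForm.at (lam : OneForm E M) (x : M) : TangentSpace 𝓘(ℝ, E) x →L[ℝ] ℝ := lam x

/-- The expression of the one-form `lam` in the preferred chart `φ` at `x`: the pullback
`(φ⁻¹)^* lam`, as a one-form on the model space `E`. Its values off the target of the chart are
irrelevant. -/
def OneForm.inChart (lam : OneForm E M) (x : M) (u : E) : E →L[ℝ] ℝ :=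
  (lam.at ((extChartAt 𝓘(ℝ, E) x).symm u)).comp
    (mfderiv 𝓘(ℝ, E) 𝓘(ℝ, E) (extChartAt 𝓘(ℝ, E) x).symm u)

/-- The exterior derivative `d lam` at `x`, as a bilinear function of two tangent vectors at `x`:
the exterior derivative of the expression of `lam` in the preferred chart at `x`. (In Mathlib the
tangent space at `x` is the model space `E`, identified through the preferred chart at `x`.) -/
def OneForm.d (lam : OneForm E M) (x : M) (v w : TangentSpace 𝓘(ℝ, E) x) : ℝ :=
  extDeriv (fun u : E => ContinuousAlternatingMap.ofSubsingleton ℝ E ℝ (0 : Fin 1)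
    (lam.inChart x u)) (extChartAt 𝓘(ℝ, E) x x) ![v, w]

/-- `(M, lam)` is an exact symplectic manifold: `d lam` is nondegenerate at every point. -/
def IsExactSymplectic (lam : OneForm E M) : Prop :=
  ∀ (x : M) (v : TangentSpace 𝓘(ℝ, E) x), (∀ w, lam.d x v w = 0) → v = 0

open Classical in
/-- The Liouville vector field `L` of `lam`, determined by `d lam (L, ·) = lam`. -/
def liouvilleField (lam : OneForm E M) (x : M) : TangentSpace 𝓘(ℝ, E) x :=
  if h : ∃ v : TangentSpace 𝓘(ℝ, E) x, ∀ w, lam.d x v w = lam.at x w then h.choose else 0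

/-- On an exact symplectic manifold the Liouville field satisfies its defining equation. -/
theorem liouvilleField_spec [FiniteDimensional ℝ E] {lam : OneForm E M}
    (h : IsExactSymplectic lam) (x : M) (w : TangentSpace 𝓘(ℝ, E) x) :
    lam.d x (liouvilleField lam x) w = lam.at x w := by
  let η := extDeriv (fun u : E => ContinuousAlternatingMap.ofSubsingleton ℝ E ℝ (0 : Fin 1)
    (lam.inChart x u)) (extChartAt 𝓘(ℝ, E) x x)
  let B : E →ₗ[ℝ] Module.Dual ℝ E := LinearMap.mk₂ ℝ (fun v w => η ![v, w])
    (fun a b c => by simpa using η.vecCons_add (m := ![c]) a b)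
    (fun a b c => by simpa using η.vecCons_smul (m := ![c]) a b)
    (fun a b c => by
      have := η.map_update_add ![a, 0] 1 b c
      have e (z : E) : Function.update ![a, 0] 1 z = ![a, z] := by
        ext i; fin_cases i <;> rfl
      rwa [e, e, e] at this)
    (fun a b c => by
      have := η.map_update_smul ![b, 0] 1 a c
      have e (z : E) : Function.update ![b, 0] 1 z = ![b, z] := by
        ext i; fin_cases i <;> rfl
      rwa [e, e] at this)
  have hB : Function.Injective B := by
    rw [injective_iff_map_eq_zero]
    intro v hv
    exact h x v fun w => LinearMap.congr_fun hv w
  have hs : Function.Surjective B :=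
    (LinearMap.injective_iff_surjective_of_finrank_eq_finrank
      (Subspace.dual_finrank_eq).symm).1 hB
  obtain ⟨v, hv⟩ := hs (lam.at x).toLinearMap
  have hex : ∃ v : TangentSpace 𝓘(ℝ, E) x, ∀ w, lam.d x v w = lam.at x w :=
    ⟨v, fun w => LinearMap.congr_fun hv w⟩
  rw [liouvilleField, dif_pos hex]
  exact hex.choose_spec w

/-- `(M, lam)` is an open Liouville domain: it is an exact symplectic manifold, the flow `Φ t` of
the Liouville field exists on all of `M` for every time `t ≤ 0`, and for `t < 0` the image of `M`
under `Φ t` has compact closure in `M`. The values `Φ t x` with `0 < t` are irrelevant; the others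
are determined by `lam`, by uniqueness of integral curves. -/
def IsOpenLiouvilleDomain (lam : OneForm E M) : Prop :=
  IsExactSymplectic lam ∧
    ∃ Φ : ℝ → M → M,
      (∀ x, Φ 0 x = x) ∧
      (∀ x, IsMIntegralCurveOn (I := 𝓘(ℝ, E)) (fun t => Φ t x) (liouvilleField lam)
        (Set.Iic 0)) ∧
      ∀ t < 0, IsCompact (closure (Set.range (Φ t)))

/-- The smooth chart `e` of `M` around `x` straightens the boundary of `X` at `x`: in `e`, the set
`X` is a closed half-space `{ℓ ≤ ℓ (e x)}` whose boundary hyperplane passes through `e x`. -/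
def IsBoundarySliceChart (X : Set M) (x : M) (e : OpenPartialHomeomorph M E) (ℓ : E →L[ℝ] ℝ) :
    Prop :=
  e ∈ IsManifold.maximalAtlas 𝓘(ℝ, E) ∞ M ∧ x ∈ e.source ∧ ℓ ≠ 0 ∧
    ∀ y ∈ e.source, y ∈ X ↔ ℓ (e y) ≤ ℓ (e x)

/-- `(X, lam|_X)` is a Liouville domain, for a subset `X` of the exact symplectic manifold
`(M, lam)`: `X` is compact, it is an embedded submanifold with boundary of codimension zero (every
point of `X` is an interior point of `X` or has a boundary slice chart), and the Liouville field
points outward along the boundary of `X`. As the codimension is zero, `d (lam|_X)` is the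
restriction of `d lam`, hence symplectic, and the Liouville field of `lam|_X` is the
restriction of that of `lam`. Pointing outward does not depend on the slice chart. -/
def IsLiouvilleSubdomain (lam : OneForm E M) (X : Set M) : Prop :=
  IsExactSymplectic lam ∧ IsCompact X ∧
    ∀ x ∈ X, x ∈ interior X ∨
      ∃ (e : OpenPartialHomeomorph M E) (ℓ : E →L[ℝ] ℝ), IsBoundarySliceChart X x e ℓ ∧
        0 < ℓ (mfderiv 𝓘(ℝ, E) 𝓘(ℝ, E) e x (liouvilleField lam x))

/-- `X` is a (strong) deformation retract of the space `Y`: there are a continuous map `r : Y → Y`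
with values in `X` and a homotopy from the identity of `Y` to `r` which is stationary on `X`
(so that `r` is a retraction onto `X`). -/
def IsDeformationRetract {Y : Type*} [TopologicalSpace Y] (X : Set Y) : Prop :=
  ∃ r : C(Y, Y), (∀ y, r y ∈ X) ∧ (ContinuousMap.id Y).HomotopicRel r X

/-- The exact symplectic manifold `(M, lam)` is tamely exhausted: every compact subset lies in a
closed subset that is a Liouville domain and a deformation retract of `M`. -/
def IsTamelyExhausted (lam : OneForm E M) : Prop :=
  IsExactSymplectic lam ∧
    ∀ K : Set M, IsCompact K →
      ∃ X : Set M, IsClosed X ∧ IsLiouvilleSubdomain lam X ∧ K ⊆ X ∧ IsDeformationRetract X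

end Liouville

end

/-! Write `Φ (-s)`, `s ≥ 0`, for the backward Liouville flow and let `K` be compact. Since `Φ (-1)`
maps `M` into a compact set, `K` lies in a compact `A` that is invariant under the backward flow and
into which every point has moved after unit time (`IsBackwardFlow.exists_isCompact_absorbing`).
Choose a smooth `g ≥ 0` vanishing exactly on `A` and let `f x` be the integral of `g (Φ (-r) x)`
over `0 ≤ r ≤ 1`. As `g` vanishes along every orbit after unit time, this is in effect the integral
over the whole backward orbit. Hence `f (Φ (-s) x)` is `f x` minus the integral of `g` over the
first `s` units of the orbit, and the derivative of `f` along the Liouville field is `g`.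

The function `f` is zero on `A` and positive off `A`. Let `B` be a compact neighbourhood of `A` and
let `c > 0` be smaller than `f` on the frontier of `B`. A backward orbit from outside `B` into `A`
crosses that frontier with `f` not increasing, so `{f ≤ c}` lies in `B` and is compact. On the level
`c` the derivative of `f` along the field is `g > 0`, so the level is regular and the field points
outward (`exists_isBoundarySliceChart`). Flowing backward until `f ≤ c` is the deformation
retraction (`isDeformationRetract_sublevel`).

The analytic work is the smoothness of `f`. The field is smooth (`contMDiff_liouvilleField`), but
the hypothesis gives only individual integral curves. Smooth dependence on the initial point comes
from inverting the Picard map on `C([0,1], E)` (`exists_contDiff_solution`), is moved to `M` by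
short-time flow boxes (`IsBackwardFlow.exists_box`), and is propagated along orbits
(`IsBackwardFlow.contMDiffAt_and_integral`). -/

open scoped Manifold ContDiff

noncomputable section

namespace Liouville

/-! ### Smoothness of post-composition on spaces of continuous functions -/

section Nemytskii

universe u v

variable {K : Type*} [TopologicalSpace K] [CompactSpace K]

/-- Pointwise evaluation of a continuous family of operators, as a bilinear map. -/
def pointwiseApply (K : Type*) [TopologicalSpace K] [CompactSpace K]
    (E F : Type*) [NormedAddCommGroup E] [NormedSpace ℝ E]
    [NormedAddCommGroup F] [NormedSpace ℝ F] :
    C(K, E →L[ℝ] F) →L[ℝ] C(K, E) →L[ℝ] C(K, F) :=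
  LinearMap.mkContinuous₂
    (LinearMap.mk₂ ℝ (fun (a : C(K, E →L[ℝ] F)) (h : C(K, E)) =>
        (⟨fun t => a t (h t), by fun_prop⟩ : C(K, F)))
      (fun a b c => by ext; simp) (fun a b c => by ext; simp)
      (fun a b c => by ext; simp) (fun a b c => by ext; simp)) 1
    (fun a h => by
      rw [ContinuousMap.norm_le _ (by rw [one_mul]; exact mul_nonneg (norm_nonneg a) (norm_nonneg h))]
      intro t
      simp only [one_mul, LinearMap.mk₂_apply, ContinuousMap.coe_mk]
      exact ((a t).le_opNorm _).trans (by gcongr <;> exact ContinuousMap.norm_coe_le_norm _ _))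

theorem pointwiseApply_apply {E F : Type*} [NormedAddCommGroup E] [NormedSpace ℝ E]
    [NormedAddCommGroup F] [NormedSpace ℝ F] (a : C(K, E →L[ℝ] F)) (h : C(K, E)) (t : K) :
    pointwiseApply K E F a h t = a t (h t) := rfl

theorem norm_pointwiseApply_le {E F : Type*} [NormedAddCommGroup E] [NormedSpace ℝ E]
    [NormedAddCommGroup F] [NormedSpace ℝ F] (a : C(K, E →L[ℝ] F)) :
    ‖pointwiseApply K E F a‖ ≤ ‖a‖ := by
  refine ContinuousLinearMap.opNorm_le_bound _ (norm_nonneg a) fun h => ?_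
  rw [ContinuousMap.norm_le _ (mul_nonneg (norm_nonneg a) (norm_nonneg h))]
  intro t
  rw [pointwiseApply_apply]
  exact ((a t).le_opNorm _).trans (by gcongr <;> exact ContinuousMap.norm_coe_le_norm _ _)

theorem contDiff_pointwiseApply {E F : Type*} [NormedAddCommGroup E] [NormedSpace ℝ E]
    [NormedAddCommGroup F] [NormedSpace ℝ F] {n : WithTop ℕ∞} :
    ContDiff ℝ n fun a : C(K, E →L[ℝ] F) => pointwiseApply K E F a :=
  (IsLinearMap.with_bound (f := fun a : C(K, E →L[ℝ] F) => pointwiseApply K E F a)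
    ⟨fun a b => by ext h t; rfl, fun c a => by ext h t; rfl⟩ 1
    fun a => (norm_pointwiseApply_le a).trans_eq (one_mul _).symm).contDiff

/-- Post-composition with a `C^1` function is differentiable on `C(K, E)`. -/
theorem hasFDerivAt_postcomp {E F : Type*} [NormedAddCommGroup E] [NormedSpace ℝ E]
    [NormedAddCommGroup F] [NormedSpace ℝ F] (w : C(E, F)) (w' : C(E, E →L[ℝ] F))
    (h : ∀ x, HasFDerivAt w (w' x) x) (γ : C(K, E)) :
    HasFDerivAt (fun γ : C(K, E) => w.comp γ) (pointwiseApply K E F (w'.comp γ)) γ := by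
  rw [hasFDerivAt_iff_isLittleO, Asymptotics.isLittleO_iff]
  intro ε hε
  have hcont : Continuous fun γ : C(K, E) => w'.comp γ := ContinuousMap.continuous_postcomp w'
  obtain ⟨δ, hδ, H⟩ := (Metric.continuousAt_iff (f := fun γ : C(K, E) => w'.comp γ) (a := γ)).1
    hcont.continuousAt ε hε
  filter_upwards [Metric.ball_mem_nhds γ hδ] with η hη
  rw [ContinuousMap.norm_le _ (by positivity)]
  intro t
  have key : ∀ y ∈ Metric.ball (γ t) δ, ‖w' y - w' (γ t)‖ ≤ ε := by
    intro y hy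
    -- Translating `γ` by a constant gives a curve through `y` at `t`, so continuity of
    -- post-composition with `w'` at `γ` bounds `w' y - w' (γ t)` uniformly in `t`.
    have h1 : dist (γ + ContinuousMap.const K (y - γ t)) γ < δ := by
      rw [ContinuousMap.dist_lt_iff hδ]
      intro s
      simpa [dist_eq_norm] using hy
    have h2 := (ContinuousMap.dist_lt_iff hε).1 (H h1) t
    rw [dist_eq_norm] at h2
    simpa using h2.le
  have hηt : η t ∈ Metric.ball (γ t) δ := (ContinuousMap.dist_lt_iff hδ).1 hη t
  have := (convex_ball (γ t) δ).norm_image_sub_le_of_norm_hasFDerivWithin_le'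
    (φ := w' (γ t)) (fun y _ => (h y).hasFDerivWithinAt) key (Metric.mem_ball_self hδ) hηt
  refine this.trans ?_
  gcongr
  exact ContinuousMap.norm_coe_le_norm (η - γ) t

/-- Induction on `n`: the derivative is again a post-composition, with target `E →L[ℝ] F`. The
universe `max u v` is closed under this change of target. -/
theorem contDiff_postcomp_nat {E : Type u} [NormedAddCommGroup E] [NormedSpace ℝ E] (n : ℕ) :
    ∀ {F : Type max u v} [NormedAddCommGroup F] [NormedSpace ℝ F] (w : C(E, F)), ContDiff ℝ n w →
      ContDiff ℝ n (fun γ : C(K, E) => w.comp γ) := by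
  induction n with
  | zero =>
    intro F _ _ w _
    rw [Nat.cast_zero, contDiff_zero]
    exact ContinuousMap.continuous_postcomp w
  | succ n ih =>
    intro F _ _ w hw
    rw [Nat.cast_add, Nat.cast_one, contDiff_succ_iff_hasFDerivAt] at hw ⊢
    obtain ⟨w', hw', h⟩ := hw
    exact ⟨fun γ => pointwiseApply K E F ((⟨w', hw'.continuous⟩ : C(E, E →L[ℝ] F)).comp γ),
      contDiff_pointwiseApply.comp (ih ⟨w', hw'.continuous⟩ hw'),
      hasFDerivAt_postcomp w ⟨w', hw'.continuous⟩ h⟩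

theorem contDiff_postcomp {E : Type u} {F : Type v} [NormedAddCommGroup E] [NormedSpace ℝ E]
    [NormedAddCommGroup F] [NormedSpace ℝ F] (w : C(E, F)) (hw : ContDiff ℝ ∞ w) :
    ContDiff ℝ ∞ (fun γ : C(K, E) => w.comp γ) := by
  -- Lifting the target puts it in the universe required by the induction.
  let up : F ≃L[ℝ] ULift.{u} F := ContinuousLinearEquiv.ulift.symm
  let w₁ : C(E, ULift.{u} F) := ⟨up ∘ w, by fun_prop⟩
  have hw₁ : ContDiff ℝ ∞ w₁ := up.contDiff.comp hw
  have h := contDiff_infty.2 fun n =>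
    contDiff_postcomp_nat.{u, v} (K := K) n w₁ (contDiff_infty.1 hw₁ n)
  exact ((up.symm : ULift.{u} F →L[ℝ] F).compLeftContinuous ℝ K).contDiff.comp h

end Nemytskii

/-! ### Short-time flows of smooth Lipschitz fields on a Banach space -/

section Flow

open unitInterval Set

variable {E F : Type*} [NormedAddCommGroup E] [NormedSpace ℝ E]
  [NormedAddCommGroup F] [NormedSpace ℝ F]

theorem continuous_extend {F : Type*} [TopologicalSpace F] (γ : C(I, F)) :
    Continuous fun s : ℝ => γ (projIcc 0 1 zero_le_one s) :=
  γ.continuous.comp continuous_projIcc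

/-- The primitive vanishing at `0` of a continuous function on the unit interval. -/
def primitive (F : Type*) [NormedAddCommGroup F] [NormedSpace ℝ F] : C(I, F) →L[ℝ] C(I, F) :=
  LinearMap.mkContinuous
    { toFun := fun γ => ⟨fun t => ∫ s in (0 : ℝ)..t, γ (projIcc 0 1 zero_le_one s),
        (intervalIntegral.continuous_primitive
          (fun a b => (continuous_extend γ).intervalIntegrable a b) 0).comp continuous_subtype_val⟩
      map_add' := fun γ η => by
        ext t
        exact intervalIntegral.integral_add ((continuous_extend γ).intervalIntegrable _ _)
          ((continuous_extend η).intervalIntegrable _ _)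
      map_smul' := fun c γ => by
        ext t
        exact intervalIntegral.integral_smul c _ } 1
    (fun γ => by
      rw [ContinuousMap.norm_le _ (by rw [one_mul]; exact norm_nonneg γ)]
      intro t
      have h := intervalIntegral.norm_integral_le_of_norm_le_const (a := 0) (b := (t : ℝ))
        (f := fun s => γ (projIcc 0 1 zero_le_one s)) (C := ‖γ‖)
        (fun s _ => γ.norm_coe_le_norm _)
      refine h.trans ?_
      rw [sub_zero, abs_of_nonneg t.2.1, mul_comm]
      exact mul_le_mul_of_nonneg_right t.2.2 (norm_nonneg γ))

theorem norm_primitive_le : ‖primitive F‖ ≤ 1 :=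
  LinearMap.mkContinuous_norm_le _ zero_le_one _

variable [CompleteSpace E]

/-- Solutions of an autonomous ODE with smooth Lipschitz right-hand side depend smoothly, as
elements of `C([0,1], E)`, on the initial value. -/
theorem exists_contDiff_solution (V : C(E, E)) (hV : ContDiff ℝ ∞ V) {c : ℝ}
    (hc : ∀ x, ‖fderiv ℝ V x‖ ≤ c) :
    ∃ δ : ℝ, 0 < δ ∧ ∃ γ : E → C(I, E), ContDiff ℝ ∞ γ ∧
      ∀ x, γ x = ContinuousMap.const I x + δ • primitive E (V.comp (γ x)) := by
  have hc0 : 0 ≤ c := (norm_nonneg _).trans (hc 0)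
  let δ : ℝ := 1 / (2 * (c + 1))
  have hδ : 0 < δ := by positivity
  have hδc : δ * c ≤ 1 / 2 := by
    simp only [δ]
    rw [div_mul_eq_mul_div, div_le_div_iff₀ (by positivity) (by positivity)]
    linarith
  -- The solution with initial value `x` is the preimage of the constant curve `x` under `θ`. By the
  -- choice of `δ`, `θ` differs from the identity by a `1/2`-Lipschitz map, so it is a global
  -- homeomorphism.
  let θ : C(I, E) → C(I, E) := fun γ => γ - δ • primitive E (V.comp γ)
  let V' : C(E, E →L[ℝ] E) := ⟨fderiv ℝ V, hV.continuous_fderiv (by simp)⟩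
  let D : C(I, E) → C(I, E) →L[ℝ] C(I, E) := fun γ =>
    δ • (primitive E).comp (pointwiseApply I E E (V'.comp γ))
  have hD : ∀ γ, ‖D γ‖ ≤ 1 / 2 := by
    intro γ
    have h1 : ‖V'.comp γ‖ ≤ c := by
      rw [ContinuousMap.norm_le _ hc0]
      exact fun t => hc _
    calc ‖D γ‖ ≤ ‖δ‖ * ‖(primitive E).comp (pointwiseApply I E E (V'.comp γ))‖ :=
          ContinuousLinearMap.opNorm_smul_le _ _
      _ = δ * ‖(primitive E).comp (pointwiseApply I E E (V'.comp γ))‖ := by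
          rw [Real.norm_of_nonneg hδ.le]
      _ ≤ δ * (‖primitive E‖ * ‖pointwiseApply I E E (V'.comp γ)‖) := by
          gcongr; exact ContinuousLinearMap.opNorm_comp_le _ _
      _ ≤ δ * (1 * c) := by
          gcongr
          · exact norm_primitive_le
          · exact (norm_pointwiseApply_le _).trans h1
      _ ≤ 1 / 2 := by rwa [one_mul]
  have hθ' : ∀ γ, HasFDerivAt θ (ContinuousLinearMap.id ℝ C(I, E) - D γ) γ := by
    intro γ
    have h1 := hasFDerivAt_postcomp (K := I) V V'
      (fun x => (hV.differentiable (by simp) x).hasFDerivAt) γ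
    exact (hasFDerivAt_id γ).sub (((primitive E).hasFDerivAt.comp γ h1).const_smul δ)
  have hθs : ContDiff ℝ ∞ θ :=
    contDiff_id.sub (((primitive E).contDiff.comp (contDiff_postcomp (K := I) V hV)).const_smul δ)
  have happ : ApproximatesLinearOn θ
      ((ContinuousLinearEquiv.refl ℝ C(I, E) : C(I, E) ≃L[ℝ] C(I, E)) : C(I, E) →L[ℝ] C(I, E))
      univ (1 / 2 : NNReal) := by
    intro γ _ η _
    have := (convex_univ (𝕜 := ℝ) (E := C(I, E))).norm_image_sub_le_of_norm_hasFDerivWithin_le'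
      (f := θ) (φ := ContinuousLinearMap.id ℝ C(I, E)) (C := 1 / 2)
      (fun y _ => (hθ' y).hasFDerivWithinAt)
      (fun y _ => by rw [sub_sub_cancel_left, norm_neg]; exact hD y) (mem_univ η) (mem_univ γ)
    simpa using this
  have hhalf : Subsingleton C(I, E) ∨ (1 / 2 : NNReal) <
      ‖((ContinuousLinearEquiv.refl ℝ C(I, E)).symm : C(I, E) →L[ℝ] C(I, E))‖₊⁻¹ := by
    rcases subsingleton_or_nontrivial C(I, E) with h | h
    · exact Or.inl h
    · right
      have : ‖((ContinuousLinearEquiv.refl ℝ C(I, E)).symm : C(I, E) →L[ℝ] C(I, E))‖₊ = 1 :=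
        ContinuousLinearMap.nnnorm_id
      rw [this, inv_one]
      exact NNReal.half_lt_self one_ne_zero
  let Θ : C(I, E) ≃ₜ C(I, E) := happ.toHomeomorph θ hhalf
  have hlt : ∀ γ, ‖D γ‖ < 1 := fun γ => (hD γ).trans_lt (by norm_num)
  -- The derivative `1 - D γ` is invertible by the Neumann series, so the inverse of `θ` is smooth.
  let e : C(I, E) → C(I, E) ≃L[ℝ] C(I, E) := fun γ =>
    ContinuousLinearEquiv.ofUnit (Units.oneSub (D γ) (hlt γ))
  have hΘ : ContDiff ℝ ∞ Θ.symm := Θ.contDiff_symm (f₀' := e) hθ' hθs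
  refine ⟨δ, hδ, fun x => Θ.symm (ContinuousMap.const I x), ?_, fun x => ?_⟩
  · let cst : E →L[ℝ] C(I, E) := ContinuousLinearMap.const ℝ I
    exact hΘ.comp cst.contDiff
  · exact eq_add_of_sub_eq (Θ.apply_symm_apply (ContinuousMap.const I x))

/-- A smooth Lipschitz vector field has a flow, for a uniform short time, which depends smoothly on
the initial value, together with all the integrals of smooth functions along it. -/
theorem exists_contDiff_flow (V : C(E, E)) (hV : ContDiff ℝ ∞ V) {c : ℝ}
    (hc : ∀ x, ‖fderiv ℝ V x‖ ≤ c) :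
    ∃ δ : ℝ, 0 < δ ∧ ∃ φ : ℝ → E → E, Continuous (fun p : ℝ × E => φ p.1 p.2) ∧
      (∀ x, φ 0 x = x) ∧ (∀ s, ContDiff ℝ ∞ (φ s)) ∧
      (∀ x, ∀ s ∈ Icc 0 δ, HasDerivWithinAt (fun r => φ r x) (V (φ s x)) (Icc 0 δ) s) ∧
      ∀ g : E → ℝ, ContDiff ℝ ∞ g → ∀ s ∈ Icc 0 δ,
        ContDiff ℝ ∞ (fun x => ∫ r in (0 : ℝ)..s, g (φ r x)) := by
  obtain ⟨δ, hδ, γ, hγ, hsol⟩ := exists_contDiff_solution V hV hc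
  have hsol' : ∀ x (t : I),
      γ x t = x + δ • ∫ s in (0 : ℝ)..t, V (γ x (projIcc 0 1 zero_le_one s)) := by
    intro x t
    conv_lhs => rw [hsol x]
    rfl
  have hmem : ∀ s ∈ Icc 0 δ, s / δ ∈ Icc (0 : ℝ) 1 := fun s hs =>
    ⟨div_nonneg hs.1 hδ.le, (div_le_one hδ).2 hs.2⟩
  -- Time is rescaled from `[0, 1]` to `[0, δ]`. Outside `[0, δ]` the curve is frozen at its
  -- endpoints, which keeps joint continuity and smoothness in `x` valid for all real `s`.
  refine ⟨δ, hδ, fun s x => γ x (projIcc 0 1 zero_le_one (s / δ)), ?_, ?_, ?_, ?_, ?_⟩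
  · have h1 : Continuous fun p : ℝ × E => γ p.2 := hγ.continuous.comp continuous_snd
    have h2 : Continuous fun p : ℝ × E => projIcc (0 : ℝ) 1 zero_le_one (p.1 / δ) :=
      continuous_projIcc.comp (continuous_fst.div_const δ)
    exact ContinuousEval.continuous_eval.comp (h1.prodMk h2)
  · intro x
    beta_reduce
    rw [hsol' x, zero_div, projIcc_of_mem _ ⟨le_rfl, zero_le_one⟩]
    simp
  · intro s
    exact (ContinuousMap.evalCLM ℝ (projIcc 0 1 zero_le_one (s / δ))).contDiff.comp hγ
  · intro x s hs
    have h1 : Continuous fun r : ℝ => V (γ x (projIcc 0 1 zero_le_one r)) :=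
      V.continuous.comp (continuous_extend (γ x))
    have h2 : HasDerivAt
        (fun u : ℝ => x + δ • ∫ r in (0 : ℝ)..u, V (γ x (projIcc 0 1 zero_le_one r)))
        (δ • V (γ x (projIcc 0 1 zero_le_one (s / δ)))) (s / δ) :=
      ((intervalIntegral.integral_hasDerivAt_right (h1.intervalIntegrable _ _)
        h1.stronglyMeasurable.stronglyMeasurableAtFilter h1.continuousAt).const_smul δ).const_add x
    have h3 : HasDerivAt (fun r : ℝ => r / δ) (1 / δ) s := (hasDerivAt_id s).div_const δ
    have h4 := (h2.scomp s h3).hasDerivWithinAt (s := Icc 0 δ)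
    rw [smul_smul, one_div_mul_cancel hδ.ne', one_smul] at h4
    refine h4.congr (fun r hr => ?_) ?_
    · beta_reduce; rw [hsol' x, projIcc_of_mem _ (hmem r hr)]; rfl
    · beta_reduce; rw [hsol' x, projIcc_of_mem _ (hmem s hs)]; rfl
  · intro g hg s hs
    -- The integral is a continuous linear functional of the curve `g ∘ γ x`, so nothing has to be
    -- differentiated under the integral sign.
    have h1 := ((ContinuousMap.evalCLM ℝ (⟨s / δ, hmem s hs⟩ : I)).contDiff.comp
      ((primitive ℝ).contDiff.comp
        ((contDiff_postcomp (K := I) (⟨g, hg.continuous⟩ : C(E, ℝ)) hg).comp hγ))).const_smul δ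
    convert h1 using 2 with x
    have := intervalIntegral.integral_comp_div (a := 0) (b := s)
      (fun r => g (γ x (projIcc 0 1 zero_le_one r))) hδ.ne'
    rw [zero_div] at this
    exact this

end Flow

/-! ### Exterior derivatives of one-forms on a normed space -/

section OneForms

variable {E : Type*} [NormedAddCommGroup E] [NormedSpace ℝ E]

theorem contDiff_flip : ContDiff ℝ ∞ fun b : E →L[ℝ] E →L[ℝ] ℝ => b.flip :=
  (IsLinearMap.with_bound (f := fun b : E →L[ℝ] E →L[ℝ] ℝ => b.flip)
    ⟨fun a b => by ext; rfl, fun c a => by ext; rfl⟩ 1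
    fun b => (b.opNorm_flip).le.trans_eq (one_mul _).symm).contDiff

/-- A covector-valued function, as a differential one-form. -/
def asForm (α : E → E →L[ℝ] ℝ) (u : E) : E [⋀^Fin 1]→L[ℝ] ℝ :=
  ContinuousAlternatingMap.ofSubsingleton ℝ E ℝ (0 : Fin 1) (α u)

theorem asForm_apply (α : E → E →L[ℝ] ℝ) (u : E) (m : Fin 1 → E) : asForm α u m = α u (m 0) := rfl

theorem differentiableAt_asForm {α : E → E →L[ℝ] ℝ} {u : E} (h : DifferentiableAt ℝ α u) :
    DifferentiableAt ℝ (asForm α) u := by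
  let S : (E →L[ℝ] ℝ) →ₗ[ℝ] E [⋀^Fin 1]→L[ℝ] ℝ :=
    { toFun := fun a => ContinuousAlternatingMap.ofSubsingleton ℝ E ℝ (0 : Fin 1) a
      map_add' := fun a b => by ext; rfl
      map_smul' := fun c a => by ext; rfl }
  let S' : (E →L[ℝ] ℝ) →L[ℝ] E [⋀^Fin 1]→L[ℝ] ℝ := S.mkContinuous 1 fun a => by
    refine ContinuousAlternatingMap.opNorm_le_bound _ (by positivity) fun m => ?_
    have h1 : S a m = a (m 0) := rfl
    rw [h1, one_mul]
    simpa using a.le_opNorm (m 0)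
  exact S'.differentiableAt.comp u h

theorem extDeriv_asForm {α : E → E →L[ℝ] ℝ} {u : E} (h : DifferentiableAt ℝ α u) (v w : E) :
    extDeriv (asForm α) u ![v, w] = fderiv ℝ α u v w - fderiv ℝ α u w v := by
  have key (c x : E) : fderiv ℝ (fun y => α y c) u x = fderiv ℝ α u x c := by
    rw [fderiv_clm_apply h (differentiableAt_const c)]
    simp
  rw [extDeriv_apply (differentiableAt_asForm h), Fin.sum_univ_two]
  simp only [asForm_apply, key]
  simp [Fin.removeNth, sub_eq_add_neg]

end OneForms

/-! ### One-forms and fields in charts; smoothness of the Liouville field -/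

section ChartFields

variable {E : Type*} [NormedAddCommGroup E] [NormedSpace ℝ E]
  {M : Type*} [TopologicalSpace M] [ChartedSpace E M]

/-- The expression in the preferred chart at `z` of a vector field. -/
def chartField (V : (x : M) → TangentSpace 𝓘(ℝ, E) x) (z : M) (u : E) : E :=
  mfderiv 𝓘(ℝ, E) 𝓘(ℝ, E) (extChartAt 𝓘(ℝ, E) z) ((extChartAt 𝓘(ℝ, E) z).symm u)
    (V ((extChartAt 𝓘(ℝ, E) z).symm u))

theorem chartField_apply (V : (x : M) → TangentSpace 𝓘(ℝ, E) x) {z y : M}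
    (hy : y ∈ (extChartAt 𝓘(ℝ, E) z).source) :
    chartField V z (extChartAt 𝓘(ℝ, E) z y) =
      mfderiv 𝓘(ℝ, E) 𝓘(ℝ, E) (extChartAt 𝓘(ℝ, E) z) y (V y) :=
  congrArg (fun p : M => (mfderiv 𝓘(ℝ, E) 𝓘(ℝ, E) (extChartAt 𝓘(ℝ, E) z) p (V p) : E))
    ((extChartAt 𝓘(ℝ, E) z).left_inv hy)

variable [IsManifold 𝓘(ℝ, E) ∞ M]

theorem contMDiffAt_extChartAt_symm' (z : M) {u : E} (hu : u ∈ (extChartAt 𝓘(ℝ, E) z).target) :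
    ContMDiffAt 𝓘(ℝ, E) 𝓘(ℝ, E) ∞ (extChartAt 𝓘(ℝ, E) z).symm u :=
  (contMDiffOn_extChartAt_symm z).contMDiffAt ((isOpen_extChartAt_target z).mem_nhds hu)

/-- Smoothness of a section is phrased through bundle trivializations; this identity transfers it to
the chart expression. -/
theorem OneForm.inChart_eq_inCoordinates (lam : OneForm E M) (z : M) {u : E}
    (hu : u ∈ (extChartAt 𝓘(ℝ, E) z).target) :
    lam.inChart z u = ContinuousLinearMap.inCoordinates E (TangentSpace 𝓘(ℝ, E)) ℝ
      (Bundle.Trivial M ℝ) z ((extChartAt 𝓘(ℝ, E) z).symm u) z ((extChartAt 𝓘(ℝ, E) z).symm u)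
      (lam ((extChartAt 𝓘(ℝ, E) z).symm u)) := by
  have hy : (extChartAt 𝓘(ℝ, E) z).symm u ∈ (chartAt E z).source := by
    rw [← extChartAt_source 𝓘(ℝ, E)]
    exact (extChartAt 𝓘(ℝ, E) z).map_target hu
  rw [ContinuousLinearMap.inCoordinates, TangentBundle.symmL_trivializationAt hy,
    PartialEquiv.right_inv _ hu]
  ext w
  simp [OneForm.inChart, OneForm.at]

theorem OneForm.contDiffAt_inChart (lam : OneForm E M) (z : M) :
    ContDiffAt ℝ ∞ (lam.inChart z) (extChartAt 𝓘(ℝ, E) z z) := by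
  have h := ((contMDiffAt_hom_bundle _).1 (lam.contMDiff z)).2
  have hz := contMDiffAt_extChartAt_symm' (E := E) z (mem_extChartAt_target z)
  have h3 := (h.comp_of_eq hz (extChartAt_to_inv z)).contDiffAt
  refine h3.congr_of_eventuallyEq ?_
  filter_upwards [extChartAt_target_mem_nhds (I := 𝓘(ℝ, E)) z] with u hu
  exact lam.inChart_eq_inCoordinates z hu

/-- All tangent spaces are definitionally `E`, so covectors at equal points can be compared there
without a transport. -/
theorem OneForm.at_congr (lam : OneForm E M) {p q : M} (h : p = q) :
    @Eq (E →L[ℝ] ℝ) (lam.at p) (lam.at q) := by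
  subst h
  rfl

/-- Transition map between preferred charts. -/
def transition (E : Type*) [NormedAddCommGroup E] [NormedSpace ℝ E] {M : Type*}
    [TopologicalSpace M] [ChartedSpace E M] (z y : M) (u : E) : E :=
  extChartAt 𝓘(ℝ, E) y ((extChartAt 𝓘(ℝ, E) z).symm u)

theorem contDiffAt_transition {z y : M} {u : E} (hu : u ∈ (extChartAt 𝓘(ℝ, E) z).target)
    (hy : (extChartAt 𝓘(ℝ, E) z).symm u ∈ (extChartAt 𝓘(ℝ, E) y).source) :
    ContDiffAt ℝ ∞ (transition E z y) u := by
  rw [← contMDiffAt_iff_contDiffAt]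
  rw [extChartAt_source] at hy
  exact (contMDiffAt_extChartAt' hy).comp u (contMDiffAt_extChartAt_symm' z hu)

theorem hasMFDerivAt_extChartAt_symm_transition {z y : M} {u : E}
    (hu : u ∈ (extChartAt 𝓘(ℝ, E) z).target)
    (hy : (extChartAt 𝓘(ℝ, E) z).symm u ∈ (extChartAt 𝓘(ℝ, E) y).source) :
    HasMFDerivAt 𝓘(ℝ, E) 𝓘(ℝ, E) (extChartAt 𝓘(ℝ, E) z).symm u
      ((mfderiv 𝓘(ℝ, E) 𝓘(ℝ, E) (extChartAt 𝓘(ℝ, E) y).symm (transition E z y u)).comp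
        (fderiv ℝ (transition E z y) u) : E →L[ℝ] E) := by
  have h1 : HasMFDerivAt 𝓘(ℝ, E) 𝓘(ℝ, E) (transition E z y) u (fderiv ℝ (transition E z y) u) :=
    ((contDiffAt_transition hu hy).differentiableAt (by simp)).hasFDerivAt.hasMFDerivAt
  have h2 := ((contMDiffAt_extChartAt_symm' y
    ((extChartAt 𝓘(ℝ, E) y).map_source hy)).mdifferentiableAt (by simp)).hasMFDerivAt
  have h3 := HasMFDerivAt.comp u h2 h1
  refine h3.congr_of_eventuallyEq ?_
  have h4 : (extChartAt 𝓘(ℝ, E) z).symm ⁻¹' (extChartAt 𝓘(ℝ, E) y).source ∈ nhds u :=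
    (contMDiffAt_extChartAt_symm' z hu).continuousAt.preimage_mem_nhds
      ((isOpen_extChartAt_source y).mem_nhds hy)
  filter_upwards [h4] with u' hu'
  exact ((extChartAt 𝓘(ℝ, E) y).left_inv hu').symm

theorem OneForm.inChart_transition (lam : OneForm E M) {z y : M} {u : E}
    (hu : u ∈ (extChartAt 𝓘(ℝ, E) z).target)
    (hy : (extChartAt 𝓘(ℝ, E) z).symm u ∈ (extChartAt 𝓘(ℝ, E) y).source) :
    lam.inChart z u =
      (lam.inChart y (transition E z y u)).comp (fderiv ℝ (transition E z y) u) := by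
  have h1 := (hasMFDerivAt_extChartAt_symm_transition hu hy).mfderiv
  have h2 : (lam.at ((extChartAt 𝓘(ℝ, E) z).symm u) : E →L[ℝ] ℝ) =
      lam.at ((extChartAt 𝓘(ℝ, E) y).symm (transition E z y u)) :=
    lam.at_congr ((extChartAt 𝓘(ℝ, E) y).left_inv hy).symm
  rw [OneForm.inChart, h1]
  exact congrArg (fun a : E →L[ℝ] ℝ => a.comp
    ((mfderiv 𝓘(ℝ, E) 𝓘(ℝ, E) (extChartAt 𝓘(ℝ, E) y).symm (transition E z y u)).comp
        (fderiv ℝ (transition E z y) u) : E →L[ℝ] E)) h2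

/-- The exterior derivative of a one-form may be computed in any preferred chart. -/
theorem OneForm.d_eq_extDeriv_inChart (lam : OneForm E M) {z y : M}
    (hy : y ∈ (extChartAt 𝓘(ℝ, E) z).source) (v w : E) :
    lam.d y (fderiv ℝ (transition E z y) (extChartAt 𝓘(ℝ, E) z y) v)
        (fderiv ℝ (transition E z y) (extChartAt 𝓘(ℝ, E) z y) w) =
      extDeriv (asForm (lam.inChart z)) (extChartAt 𝓘(ℝ, E) z y) ![v, w] := by
  set u := extChartAt 𝓘(ℝ, E) z y with hu_def
  have hu : u ∈ (extChartAt 𝓘(ℝ, E) z).target := (extChartAt 𝓘(ℝ, E) z).map_source hy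
  have hyu : (extChartAt 𝓘(ℝ, E) z).symm u = y := (extChartAt 𝓘(ℝ, E) z).left_inv hy
  have hys : (extChartAt 𝓘(ℝ, E) z).symm u ∈ (extChartAt 𝓘(ℝ, E) y).source := by
    rw [hyu]; exact mem_extChartAt_source y
  have htr : transition E z y u = extChartAt 𝓘(ℝ, E) y y := by rw [transition, hyu]
  have h4 : (extChartAt 𝓘(ℝ, E) z).symm ⁻¹' (extChartAt 𝓘(ℝ, E) y).source ∈ nhds u :=
    (contMDiffAt_extChartAt_symm' z hu).continuousAt.preimage_mem_nhds
      ((isOpen_extChartAt_source y).mem_nhds hys)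
  -- Near `u` one chart expression is the pullback of the other by the transition map, and the
  -- exterior derivative commutes with pullback.
  have hev : asForm (lam.inChart z) =ᶠ[nhds u] fun u' =>
      (asForm (lam.inChart y) (transition E z y u')).compContinuousLinearMap
        (fderiv ℝ (transition E z y) u') := by
    filter_upwards [h4, (isOpen_extChartAt_target z).mem_nhds hu] with u' h1 h2
    ext m
    simp only [asForm_apply, lam.inChart_transition h2 h1]
    rfl
  have hd : DifferentiableAt ℝ (asForm (lam.inChart y)) (transition E z y u) := by
    rw [htr]
    exact differentiableAt_asForm ((lam.contDiffAt_inChart y).differentiableAt (by simp))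
  rw [hev.extDeriv_eq, extDeriv_pullback hd (contDiffAt_transition hu hys) (by
    rw [minSmoothness_of_isRCLikeNormedField]; exact ENat.LEInfty.out), htr]
  rw [ContinuousAlternatingMap.compContinuousLinearMap_apply]
  change extDeriv (asForm (lam.inChart y)) (extChartAt 𝓘(ℝ, E) y y) _ = _
  congr 1
  ext i
  fin_cases i <;> rfl

theorem OneForm.inChart_self (lam : OneForm E M) (y : M) :
    lam.inChart y (extChartAt 𝓘(ℝ, E) y y) = lam.at y := by
  have h1 : mfderiv 𝓘(ℝ, E) 𝓘(ℝ, E) (extChartAt 𝓘(ℝ, E) y).symm (extChartAt 𝓘(ℝ, E) y y) =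
      ContinuousLinearMap.id ℝ E := by
    have := mfderivWithin_range_extChartAt_symm (I := 𝓘(ℝ, E)) (x := y)
    rwa [modelWithCornersSelf_coe, Set.range_id, mfderivWithin_univ] at this
  have h2 : (lam.at ((extChartAt 𝓘(ℝ, E) y).symm (extChartAt 𝓘(ℝ, E) y y)) : E →L[ℝ] ℝ) =
      lam.at y := lam.at_congr (extChartAt_to_inv y)
  rw [OneForm.inChart, h1]
  exact h2

theorem trivializationAt_eq_mfderiv {z y : M} (hy : y ∈ (extChartAt 𝓘(ℝ, E) z).source)
    (v : TangentSpace 𝓘(ℝ, E) y) :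
    (trivializationAt E (TangentSpace 𝓘(ℝ, E)) z ⟨y, v⟩).2 =
      mfderiv 𝓘(ℝ, E) 𝓘(ℝ, E) (extChartAt 𝓘(ℝ, E) z) y v := by
  rw [extChartAt_source] at hy
  have hb : y ∈ (trivializationAt E (TangentSpace 𝓘(ℝ, E)) z).baseSet := by simpa using hy
  have h1 := congrArg (fun a : E →L[ℝ] E => a v)
    (TangentBundle.continuousLinearMapAt_trivializationAt (I := 𝓘(ℝ, E)) hy)
  refine Eq.trans ?_ h1
  exact (congrFun (Bundle.Trivialization.coe_linearMapAt_of_mem (R := ℝ) _ hb) v).symm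

/-- Chain rule for passing through the chart at `z` to the chart at `y`: the latter has identity
derivative at its own centre, so the vector comes back unchanged. -/
theorem fderiv_transition_chartField (V : (x : M) → TangentSpace 𝓘(ℝ, E) x) {z y : M}
    (hy : y ∈ (extChartAt 𝓘(ℝ, E) z).source) :
    fderiv ℝ (transition E z y) (extChartAt 𝓘(ℝ, E) z y)
      (chartField V z (extChartAt 𝓘(ℝ, E) z y)) = V y := by
  have hu := (extChartAt 𝓘(ℝ, E) z).map_source hy
  have hyu : (extChartAt 𝓘(ℝ, E) z).symm (extChartAt 𝓘(ℝ, E) z y) = y :=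
    (extChartAt 𝓘(ℝ, E) z).left_inv hy
  have hys : (extChartAt 𝓘(ℝ, E) z).symm (extChartAt 𝓘(ℝ, E) z y) ∈
      (extChartAt 𝓘(ℝ, E) y).source := by
    rw [hyu]; exact mem_extChartAt_source y
  have h1 := ((contDiffAt_transition hu hys).differentiableAt (by simp)).hasFDerivAt.hasMFDerivAt
  have hy' := hy
  rw [extChartAt_source] at hy'
  have h2 := (mdifferentiableAt_extChartAt (I := 𝓘(ℝ, E)) hy').hasMFDerivAt
  have h3 := HasMFDerivAt.comp y h1 h2
  have h4 : transition E z y ∘ extChartAt 𝓘(ℝ, E) z =ᶠ[nhds y] extChartAt 𝓘(ℝ, E) y := by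
    filter_upwards [(isOpen_extChartAt_source z).mem_nhds hy] with p hp
    rw [Function.comp_apply, transition, (extChartAt 𝓘(ℝ, E) z).left_inv hp]
  have h5 := (h3.congr_of_eventuallyEq h4.symm).mfderiv
  rw [mfderiv_extChartAt_self] at h5
  rw [chartField_apply V hy]
  exact (DFunLike.congr_fun h5 (V y)).symm

/-- The defining equation of the Liouville field, in a chart. -/
theorem extDeriv_inChart_chartField [FiniteDimensional ℝ E] {lam : OneForm E M}
    (h : IsExactSymplectic lam) {z y : M} (hy : y ∈ (extChartAt 𝓘(ℝ, E) z).source) (w : E) :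
    extDeriv (asForm (lam.inChart z)) (extChartAt 𝓘(ℝ, E) z y)
      ![chartField (liouvilleField lam) z (extChartAt 𝓘(ℝ, E) z y), w] =
      lam.inChart z (extChartAt 𝓘(ℝ, E) z y) w := by
  have hu := (extChartAt 𝓘(ℝ, E) z).map_source hy
  have hyu : (extChartAt 𝓘(ℝ, E) z).symm (extChartAt 𝓘(ℝ, E) z y) = y :=
    (extChartAt 𝓘(ℝ, E) z).left_inv hy
  have hys : (extChartAt 𝓘(ℝ, E) z).symm (extChartAt 𝓘(ℝ, E) z y) ∈
      (extChartAt 𝓘(ℝ, E) y).source := by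
    rw [hyu]; exact mem_extChartAt_source y
  have htr : transition E z y (extChartAt 𝓘(ℝ, E) z y) = extChartAt 𝓘(ℝ, E) y y := by
    rw [transition, hyu]
  rw [← lam.d_eq_extDeriv_inChart hy, fderiv_transition_chartField _ hy,
    lam.inChart_transition hu hys, htr, lam.inChart_self]
  exact liouvilleField_spec h y _

/-- In the chart at `z` the field solves `B u (L u) = α u`, where `α` is the chart expression of
`lam` and `B` is its antisymmetrized derivative. Nondegeneracy makes `B` invertible at the centre,
hence nearby, and operator inversion is smooth. -/
theorem contMDiff_liouvilleField [FiniteDimensional ℝ E] {lam : OneForm E M}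
    (h : IsExactSymplectic lam) :
    ContMDiff 𝓘(ℝ, E) 𝓘(ℝ, E).tangent ∞
      (fun x => (⟨x, liouvilleField lam x⟩ : TangentBundle 𝓘(ℝ, E) M)) := by
  intro z
  set φ := extChartAt 𝓘(ℝ, E) z with hφ
  have hα := lam.contDiffAt_inChart z
  let B : E → E →L[ℝ] E →L[ℝ] ℝ := fun u =>
    fderiv ℝ (lam.inChart z) u - (fderiv ℝ (lam.inChart z) u).flip
  have hdα : ContDiffAt ℝ ∞ (fderiv ℝ (lam.inChart z)) (φ z) := hα.fderiv_right (by simp)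
  have hB : ContDiffAt ℝ ∞ B (φ z) :=
    hdα.sub (contDiff_flip.contDiffAt.comp _ hdα)
  have hBapp : ∀ u, DifferentiableAt ℝ (lam.inChart z) u → ∀ v w,
      B u v w = extDeriv (asForm (lam.inChart z)) u ![v, w] := fun u hu v w =>
    (extDeriv_asForm hu v w).symm
  have hinj : Function.Injective (B (φ z)) := by
    rw [injective_iff_map_eq_zero]
    intro v hv
    refine h z v fun w => ?_
    have := hBapp _ (hα.differentiableAt (by simp)) v w
    rw [hv] at this
    exact this.symm
  have hinv : (B (φ z)).IsInvertible := by
    have hfin : Module.finrank ℝ E = Module.finrank ℝ (E →L[ℝ] ℝ) := by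
      rw [← Subspace.dual_finrank_eq (K := ℝ) (V := E)]
      exact (LinearMap.toContinuousLinearMap (𝕜 := ℝ) (E := E) (F' := ℝ)).finrank_eq
    exact ⟨(LinearEquiv.ofInjectiveOfFinrankEq (B (φ z)).toLinearMap hinj
      hfin).toContinuousLinearEquiv, by ext; rfl⟩
  have hsol : ContDiffAt ℝ ∞ (fun u => (B u).inverse (lam.inChart z u)) (φ z) :=
    (hinv.contDiffAt_map_inverse.comp _ hB).clm_apply hα
  have hev : ∀ᶠ u in nhds (φ z), chartField (liouvilleField lam) z u =
      (B u).inverse (lam.inChart z u) := by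
    have h1 : ∀ᶠ u in nhds (φ z), DifferentiableAt ℝ (lam.inChart z) u :=
      ((hα.of_le (m := 1) (by simp)).eventually (by simp)).mono fun u hu =>
        hu.differentiableAt (by simp)
    have h2 : ∀ᶠ u in nhds (φ z), (B u).IsInvertible := by
      obtain ⟨e, he⟩ := hinv
      refine (hB.continuousAt.eventually (p := fun b => b.IsInvertible) ?_)
      rw [← he]
      exact e.nhds
    filter_upwards [h1, h2, extChartAt_target_mem_nhds (I := 𝓘(ℝ, E)) z] with u hd hi hu
    have hy := φ.map_target hu
    have huy : φ (φ.symm u) = u := φ.right_inv hu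
    have heq : B u (chartField (liouvilleField lam) z u) = lam.inChart z u := by
      ext w
      have := extDeriv_inChart_chartField h hy w
      rw [huy] at this
      rw [hBapp u hd, this]
    exact (hi.inverse_apply_eq.2 heq.symm).symm
  refine (Bundle.contMDiffAt_section _).2 ?_
  have hchart : ContMDiffAt 𝓘(ℝ, E) 𝓘(ℝ, E) ∞ φ z := contMDiffAt_extChartAt
  have h3 := (contMDiffAt_iff_contDiffAt.2 (hsol.congr_of_eventuallyEq hev)).comp z hchart
  refine h3.congr_of_eventuallyEq ?_
  filter_upwards [(isOpen_extChartAt_source (I := 𝓘(ℝ, E)) z).mem_nhds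
    (mem_extChartAt_source z)] with y hy
  rw [Function.comp_apply, chartField_apply _ hy]
  exact trivializationAt_eq_mfderiv hy _

/-- A smooth vector field has smooth expressions in charts. -/
theorem contDiffOn_chartField {V : (x : M) → TangentSpace 𝓘(ℝ, E) x}
    (hV : ContMDiff 𝓘(ℝ, E) 𝓘(ℝ, E).tangent ∞
      (fun x => (⟨x, V x⟩ : TangentBundle 𝓘(ℝ, E) M))) (z : M) :
    ContDiffOn ℝ ∞ (chartField V z) (extChartAt 𝓘(ℝ, E) z).target := by
  intro u hu
  set φ := extChartAt 𝓘(ℝ, E) z with hφ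
  have hy : φ.symm u ∈ φ.source := φ.map_target hu
  have hb : φ.symm u ∈ (trivializationAt E (TangentSpace 𝓘(ℝ, E)) z).baseSet := by
    rw [TangentBundle.trivializationAt_baseSet, ← extChartAt_source 𝓘(ℝ, E)]
    exact hy
  have h1 := (Bundle.Trivialization.contMDiffAt_section_iff _ hb).1 (hV (φ.symm u))
  have h2 := (h1.comp u (contMDiffAt_extChartAt_symm' z hu)).contDiffAt
  refine (h2.congr_of_eventuallyEq ?_).contDiffWithinAt
  filter_upwards [(isOpen_extChartAt_target (I := 𝓘(ℝ, E)) z).mem_nhds hu] with u' hu'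
  exact (trivializationAt_eq_mfderiv (φ.map_target hu') _).symm

end ChartFields

open Set Topology Filter

/-! ### Integral curves up to an endpoint, and flow boxes -/

section

section Bump

variable {E F : Type*} [NormedAddCommGroup E] [NormedSpace ℝ E]
  [NormedAddCommGroup F] [NormedSpace ℝ F]

theorem contDiff_smul_of_tsupport_subset {χ : E → ℝ} (hχ : ContDiff ℝ ∞ χ) {s : Set E}
    (hs : IsOpen s) (hsupp : tsupport χ ⊆ s) {f : E → F} (hf : ContDiffOn ℝ ∞ f s) :
    ContDiff ℝ ∞ fun u => χ u • f u := by
  rw [contDiff_iff_contDiffAt]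
  intro u
  by_cases hu : u ∈ s
  · exact hχ.contDiffAt.smul (hf.contDiffAt (hs.mem_nhds hu))
  · have h1 : u ∉ tsupport χ := fun h => hu (hsupp h)
    refine (contDiffAt_const (c := (0 : F))).congr_of_eventuallyEq ?_
    filter_upwards [notMem_tsupport_iff_eventuallyEq.1 h1] with u' hu'
    rw [hu', Pi.zero_apply, zero_smul]

theorem exists_bound_fderiv_of_hasCompactSupport {f : E → F} (hf : ContDiff ℝ ∞ f)
    (hc : HasCompactSupport f) : ∃ c, ∀ x, ‖fderiv ℝ f x‖ ≤ c :=
  (hc.fderiv ℝ).exists_bound_of_continuous (hf.continuous_fderiv (by simp))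

end Bump

variable {E : Type*} [NormedAddCommGroup E] [NormedSpace ℝ E]
  {M : Type*} [TopologicalSpace M] [ChartedSpace E M]
  {V : (x : M) → TangentSpace 𝓘(ℝ, E) x}

theorem mfderiv_extChartAt_symm_chartField (V : (x : M) → TangentSpace 𝓘(ℝ, E) x)
    [IsManifold 𝓘(ℝ, E) ∞ M] {z : M} {u : E}
    (hu : u ∈ (extChartAt 𝓘(ℝ, E) z).target) :
    @Eq E (mfderiv 𝓘(ℝ, E) 𝓘(ℝ, E) (extChartAt 𝓘(ℝ, E) z).symm u (chartField (E := E) V z u))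
      (V ((extChartAt 𝓘(ℝ, E) z).symm u)) := by
  have h := mfderivWithin_extChartAt_symm_comp_mfderiv_extChartAt (I := 𝓘(ℝ, E)) hu
  rw [modelWithCornersSelf_coe, Set.range_id, mfderivWithin_univ] at h
  exact DFunLike.congr_fun h (V ((extChartAt 𝓘(ℝ, E) z).symm u))

/-- The curve `γ` has velocity `v` at `t`, within `s`; here `v` is a vector of the model space,
identified with a tangent vector at `γ t`. -/
def HasVelocityWithinAt (γ : ℝ → M) (v : E) (s : Set ℝ) (t : ℝ) : Prop :=
  HasMFDerivWithinAt 𝓘(ℝ, ℝ) 𝓘(ℝ, E) γ s t ((1 : ℝ →L[ℝ] ℝ).smulRight v : ℝ →L[ℝ] E)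

theorem isMIntegralCurveOn_iff_hasVelocityWithinAt {γ : ℝ → M} {s : Set ℝ} :
    IsMIntegralCurveOn γ V s ↔ ∀ t ∈ s, HasVelocityWithinAt (E := E) γ (V (γ t)) s t := Iff.rfl

theorem field_congr (V : (x : M) → TangentSpace 𝓘(ℝ, E) x) {p q : M} (h : p = q) :
    @Eq E (V p) (V q) := by
  subst h
  rfl

namespace HasVelocityWithinAt

variable {γ β : ℝ → M} {v : E} {s s' : Set ℝ} {t : ℝ}

theorem congr_of_mem_nhdsWithin (h : HasVelocityWithinAt γ v s t) (hs : s ∈ 𝓝[s'] t)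
    (he : ∀ r ∈ s', β r = γ r) (ht : β t = γ t) : HasVelocityWithinAt β v s' t :=
  (HasMFDerivWithinAt.mono_of_mem_nhdsWithin h hs).congr_mono he ht subset_rfl

theorem union (h : HasVelocityWithinAt γ v s t) (h' : HasVelocityWithinAt γ v s' t) :
    HasVelocityWithinAt γ v (s ∪ s') t :=
  HasMFDerivWithinAt.union h h'

end HasVelocityWithinAt

/-- Gluing an integral curve up to time `0` with an integral curve around time `0`. -/
theorem isMIntegralCurveOn_glue {γ β : ℝ → M} {a ε : ℝ} (ha : 0 < a) (hε : 0 < ε)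
    (hγ : IsMIntegralCurveOn γ V (Icc (-a) 0)) (hβ : IsMIntegralCurveOn β V (Ioo (-ε) ε))
    (h0 : β 0 = γ 0) :
    IsMIntegralCurveOn (fun t => if t ≤ 0 then γ t else β t) V (Ioo (-a) ε) := by
  rw [isMIntegralCurveOn_iff_hasVelocityWithinAt] at *
  have hpos : ∀ r : ℝ, 0 ≤ r → (if r ≤ 0 then γ r else β r) = β r := by
    intro r hr
    rcases eq_or_lt_of_le hr with rfl | h
    · exact (if_pos le_rfl).trans h0.symm
    · exact if_neg (not_le.2 h)
  have hneg : ∀ r : ℝ, r ≤ 0 → (if r ≤ 0 then γ r else β r) = γ r := fun r hr => if_pos hr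
  have left : ∀ t ∈ Ioc (-a) 0, HasVelocityWithinAt (E := E) (fun t => if t ≤ 0 then γ t else β t)
      (V (γ t)) (Ioc (-a) 0) t := fun t ht =>
    (hγ t ⟨ht.1.le, ht.2⟩).congr_of_mem_nhdsWithin
      (mem_of_superset self_mem_nhdsWithin Ioc_subset_Icc_self) (fun r hr => hneg r hr.2)
      (hneg t ht.2)
  have right : ∀ t ∈ Ico 0 ε, HasVelocityWithinAt (E := E) (fun t => if t ≤ 0 then γ t else β t)
      (V (β t)) (Ico 0 ε) t := fun t ht =>
    (hβ t ⟨by linarith [ht.1], ht.2⟩).congr_of_mem_nhdsWithin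
      (mem_of_superset self_mem_nhdsWithin fun r hr => ⟨by linarith [hr.1], hr.2⟩)
      (fun r hr => hpos r hr.1) (hpos t ht.1)
  intro t ht
  have hun : Ioo (-a) ε = Ioc (-a) 0 ∪ Ico 0 ε := (Ioc_union_Ico_eq_Ioo (by linarith) hε).symm
  rcases lt_trichotomy t 0 with h | rfl | h
  · rw [field_congr V (hneg t h.le)]
    exact (left t ⟨ht.1, h.le⟩).congr_of_mem_nhdsWithin
      (mem_nhdsWithin_of_mem_nhds (Ioc_mem_nhds ht.1 h)) (fun _ _ => rfl) rfl
  · rw [field_congr V (hneg 0 le_rfl), hun]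
    refine (left 0 ⟨ht.1, le_rfl⟩).union ?_
    rw [← field_congr V h0]
    exact right 0 ⟨le_rfl, hε⟩
  · rw [field_congr V (hpos t h.le)]
    exact (right t ⟨h.le, ht.2⟩).congr_of_mem_nhdsWithin
      (mem_nhdsWithin_of_mem_nhds (Ico_mem_nhds h ht.2)) (fun _ _ => rfl) rfl

variable [IsManifold 𝓘(ℝ, E) ∞ M]

/-- Uniqueness of integral curves up to time `0` with a given value at the endpoint `0`. -/
theorem eqOn_of_isMIntegralCurveOn_Icc [CompleteSpace E] [T2Space M]
    (hV : ContMDiff 𝓘(ℝ, E) 𝓘(ℝ, E).tangent ∞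
      (fun x => (⟨x, V x⟩ : TangentBundle 𝓘(ℝ, E) M)))
    {γ γ' : ℝ → M} {a : ℝ} (hγ : IsMIntegralCurveOn γ V (Icc (-a) 0))
    (hγ' : IsMIntegralCurveOn γ' V (Icc (-a) 0)) (h0 : γ 0 = γ' 0) :
    EqOn γ γ' (Ioc (-a) 0) := by
  intro t ht
  have ha : 0 < a := by linarith [ht.1, ht.2]
  have hV1 := hV.of_le (n := ∞) (m := 1) (by simp)
  -- Both curves are continued past the endpoint `0` by the same local solution `β`, which reduces
  -- the claim to uniqueness on an open interval.
  obtain ⟨β, hβ0, hβ⟩ := exists_isMIntegralCurveAt_of_contMDiffAt_boundaryless (I := 𝓘(ℝ, E)) 0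
    (hV1 (γ 0))
  obtain ⟨ε, hε, hβ⟩ := isMIntegralCurveAt_iff'.1 hβ
  rw [Real.ball_eq_Ioo, zero_sub, zero_add] at hβ
  have h1 := isMIntegralCurveOn_glue ha hε hγ hβ hβ0
  have h2 := isMIntegralCurveOn_glue ha hε hγ' hβ (hβ0.trans h0)
  have h3 := isMIntegralCurveOn_Ioo_eqOn_of_contMDiff_boundaryless (t₀ := 0)
    ⟨by linarith, hε⟩ hV1 h1 h2 (by simpa using h0)
  simpa [ht.2] using h3 ⟨ht.1, ht.2.trans_lt hε⟩

/-- A semiflow of `V` for nonpositive times. -/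
structure IsBackwardFlow (V : (x : M) → TangentSpace 𝓘(ℝ, E) x) (Φ : ℝ → M → M) : Prop where
  smooth : ContMDiff 𝓘(ℝ, E) 𝓘(ℝ, E).tangent ∞ (fun x => (⟨x, V x⟩ : TangentBundle 𝓘(ℝ, E) M))
  zero : ∀ x, Φ 0 x = x
  integralCurve : ∀ x, IsMIntegralCurveOn (I := 𝓘(ℝ, E)) (fun t => Φ t x) V (Iic 0)

namespace IsBackwardFlow

variable {Φ : ℝ → M → M}

theorem comp [CompleteSpace E] [T2Space M] (h : IsBackwardFlow V Φ) {s t : ℝ} (hs : s ≤ 0)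
    (ht : t ≤ 0) (x : M) : Φ s (Φ t x) = Φ (s + t) x := by
  have h1 : IsMIntegralCurveOn (fun r => Φ (r + t) x) V (Icc (-(1 - s)) 0) :=
    ((h.integralCurve x).comp_add t).mono fun r hr => by
      have := hr.2
      simp only [mem_ofPred_eq, mem_Iic]
      linarith
  have h2 : IsMIntegralCurveOn (fun r => Φ r (Φ t x)) V (Icc (-(1 - s)) 0) :=
    (h.integralCurve _).mono fun r hr => hr.2
  exact eqOn_of_isMIntegralCurveOn_Icc h.smooth h2 h1 (by simp [h.zero]) ⟨by linarith, hs⟩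

theorem continuousOn_curve (h : IsBackwardFlow V Φ) (x : M) :
    ContinuousOn (fun s => Φ (-s) x) (Ici 0) :=
  (h.integralCurve x).continuousOn.comp continuous_neg.continuousOn fun s hs => by
    simpa using hs

/-- In a chart, multiply `-V` by a bump function; the result is compactly supported, hence
Lipschitz, and has a smooth short-time flow. Near the centre that flow stays where the bump is `1`,
so by uniqueness it is the chart expression of `Φ (-s)`. -/
theorem exists_box [FiniteDimensional ℝ E] [T2Space M] (h : IsBackwardFlow V Φ) (z : M) :
    ∃ N : Set M, IsOpen N ∧ z ∈ N ∧ ∃ δ : ℝ, 0 < δ ∧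
      ContinuousOn (fun p : ℝ × M => Φ (-p.1) p.2) (Icc 0 δ ×ˢ N) ∧
      (∀ s ∈ Icc 0 δ, ContMDiffOn 𝓘(ℝ, E) 𝓘(ℝ, E) ∞ (Φ (-s)) N) ∧
      ∀ g : M → ℝ, ContMDiff 𝓘(ℝ, E) 𝓘(ℝ, ℝ) ∞ g → ∀ s ∈ Icc 0 δ,
        ContMDiffOn 𝓘(ℝ, E) 𝓘(ℝ, ℝ) ∞ (fun x => ∫ r in (0 : ℝ)..s, g (Φ (-r) x)) N := by
  have := FiniteDimensional.complete ℝ E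
  set φ := extChartAt 𝓘(ℝ, E) z with hφ
  obtain ⟨R, hR, hRt⟩ := Metric.nhds_basis_closedBall.mem_iff.1
    (extChartAt_target_mem_nhds (I := 𝓘(ℝ, E)) z)
  let χ : ContDiffBump (φ z) := ⟨R / 2, R, by positivity, by linarith⟩
  have hχs : tsupport χ ⊆ φ.target := by rw [χ.tsupport_eq]; exact hRt
  have hto : IsOpen φ.target := isOpen_extChartAt_target z
  have hW : ContDiff ℝ ∞ fun u => χ u • -chartField V z u :=
    contDiff_smul_of_tsupport_subset χ.contDiff hto hχs (contDiffOn_chartField h.smooth z).neg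
  have hWc : HasCompactSupport fun u => χ u • -chartField V z u :=
    χ.hasCompactSupport.smul_right
  obtain ⟨c, hc⟩ := exists_bound_fderiv_of_hasCompactSupport hW hWc
  obtain ⟨δ₀, hδ₀, F, hFc, hF0, hFs, hFd, hFg⟩ :=
    exists_contDiff_flow ⟨_, hW.continuous⟩ hW hc
  have hO : {p : ℝ × E | F p.1 p.2 ∈ Metric.ball (φ z) (R / 2)} ∈ 𝓝 ((0 : ℝ), φ z) :=
    hFc.continuousAt.preimage_mem_nhds (by
      rw [hF0]; exact Metric.ball_mem_nhds _ (by positivity))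
  obtain ⟨A, hA, B, hB, hAB⟩ := mem_nhds_prod_iff.1 hO
  obtain ⟨δ₁, hδ₁, hA⟩ := Metric.nhds_basis_closedBall.mem_iff.1 hA
  obtain ⟨B', hB'B, hB'o, hzB'⟩ := mem_nhds_iff.1 hB
  set δ := min δ₀ δ₁ with hδdef
  have hδ : 0 < δ := lt_min hδ₀ hδ₁
  have hball : ∀ s ∈ Icc 0 δ, ∀ u ∈ B', F s u ∈ Metric.ball (φ z) (R / 2) := by
    intro s hs u hu
    refine hAB (mk_mem_prod (hA ?_) (hB'B hu))
    rw [Metric.mem_closedBall, Real.dist_0_eq_abs, abs_of_nonneg hs.1]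
    exact hs.2.trans (min_le_right _ _)
  have htgt : ∀ s ∈ Icc 0 δ, ∀ u ∈ B', F s u ∈ φ.target := fun s hs u hu =>
    hRt (Metric.ball_subset_closedBall (Metric.ball_subset_ball (by linarith) (hball s hs u hu)))
  have hone : ∀ s ∈ Icc 0 δ, ∀ u ∈ B', χ (F s u) = 1 := fun s hs u hu =>
    χ.one_of_mem_closedBall (Metric.ball_subset_closedBall (hball s hs u hu))
  let N := φ.source ∩ φ ⁻¹' B'
  have hNo : IsOpen N := (continuousOn_extChartAt z).isOpen_inter_preimage
    (isOpen_extChartAt_source z) hB'o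
  have hcurve : ∀ x ∈ N, ∀ s ∈ Ico 0 δ, Φ (-s) x = φ.symm (F s (φ x)) := by
    intro x hx s hs
    have h1 : IsMIntegralCurveOn (fun t => φ.symm (F (-t) (φ x))) V (Icc (-δ) 0) := by
      intro t ht
      have ht' : -t ∈ Icc 0 δ := ⟨by linarith [ht.2], by linarith [ht.1]⟩
      have hd := (hFd (φ x) (-t) ⟨ht'.1, ht'.2.trans (min_le_left _ _)⟩).mono
        (Icc_subset_Icc_right (min_le_left δ₀ δ₁))
      have hd2 := hd.scomp t ((hasDerivAt_neg t).hasDerivWithinAt (s := Icc (-δ) 0))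
        (fun r hr => ⟨by linarith [hr.2], by linarith [hr.1]⟩)
      have hval : (-1 : ℝ) • (χ (F (-t) (φ x)) • -chartField V z (F (-t) (φ x))) =
          chartField V z (F (-t) (φ x)) := by
        rw [hone _ ht' _ hx.2]; simp
      have hd3 : HasDerivWithinAt (fun t => F (-t) (φ x)) (chartField V z (F (-t) (φ x)))
          (Icc (-δ) 0) t := by
        rw [← hval]; exact hd2
      have hsymm := ((contMDiffAt_extChartAt_symm' z (htgt _ ht' _ hx.2)).mdifferentiableAt
        (by simp)).hasMFDerivAt
      have h5 := hsymm.comp_hasMFDerivWithinAt t hd3.hasFDerivWithinAt.hasMFDerivWithinAt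
      have h6 := mfderiv_extChartAt_symm_chartField V (htgt _ ht' _ hx.2)
      refine HasMFDerivWithinAt.congr_mfderiv h5 ?_
      let D : E →L[ℝ] E := mfderiv 𝓘(ℝ, E) 𝓘(ℝ, E) φ.symm (F (-t) (φ x))
      let w : E := V (φ.symm (F (-t) (φ x)))
      have h7 : ∀ r : ℝ, D (r • chartField V z (F (-t) (φ x))) = r • w := fun r => by
        rw [map_smul]
        exact congrArg (fun a : E => r • a) h6
      exact ContinuousLinearMap.ext h7
    have h2 : IsMIntegralCurveOn (fun t => Φ t x) V (Icc (-δ) 0) :=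
      (h.integralCurve x).mono fun r hr => hr.2
    have h3 := eqOn_of_isMIntegralCurveOn_Icc h.smooth h2 h1
      (by simpa only [h.zero, neg_zero, hF0] using (φ.left_inv hx.1).symm)
      (x := -s) ⟨by linarith [hs.2], by linarith [hs.1]⟩
    simpa only [neg_neg] using h3
  -- The uniqueness statement omits the far endpoint `δ`, so the box is cut to half its length.
  have hsub : Icc 0 (δ / 2) ⊆ Ico 0 δ := fun s hs => ⟨hs.1, by linarith [hs.2]⟩
  have hφN : ContMDiffOn 𝓘(ℝ, E) 𝓘(ℝ, E) ∞ φ N :=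
    (contMDiffOn_extChartAt (I := 𝓘(ℝ, E))).mono fun x hx => by
      rw [← extChartAt_source 𝓘(ℝ, E)]; exact hx.1
  refine ⟨N, hNo, ⟨mem_extChartAt_source z, hzB'⟩, δ / 2, by positivity, ?_, ?_, ?_⟩
  · have h1 : ContinuousOn (fun p : ℝ × M => φ.symm (F p.1 (φ p.2))) (Icc 0 (δ / 2) ×ˢ N) := by
      refine (continuousOn_extChartAt_symm z).comp
        (hFc.comp_continuousOn (continuousOn_fst.prodMk
          (hφN.continuousOn.comp continuousOn_snd fun p hp => hp.2))) ?_
      exact fun p hp => htgt _ (Ico_subset_Icc_self (hsub hp.1)) _ hp.2.2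
    exact h1.congr fun p hp => hcurve _ hp.2 _ (hsub hp.1)
  · intro s hs
    have h1 : ContMDiffOn 𝓘(ℝ, E) 𝓘(ℝ, E) ∞ (fun x => φ.symm (F s (φ x))) N := by
      refine (contMDiffOn_extChartAt_symm z).comp
        ((hFs s).contMDiff.comp_contMDiffOn hφN) ?_
      exact fun x hx => htgt _ (Ico_subset_Icc_self (hsub hs)) _ hx.2
    exact h1.congr fun x hx => hcurve _ hx _ (hsub hs)
  · intro g hg s hs
    have hG : ContDiff ℝ ∞ fun u => χ u • g (φ.symm u) :=
      contDiff_smul_of_tsupport_subset χ.contDiff hto hχs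
        (hg.comp_contMDiffOn (contMDiffOn_extChartAt_symm z)).contDiffOn
    have h1 : ContMDiffOn 𝓘(ℝ, E) 𝓘(ℝ, ℝ) ∞
        (fun x => ∫ r in (0 : ℝ)..s, χ (F r (φ x)) • g (φ.symm (F r (φ x)))) N :=
      (hFg _ hG s ⟨hs.1, (hsub hs).2.le.trans (min_le_left _ _)⟩).contMDiff.comp_contMDiffOn hφN
    refine h1.congr fun x hx => ?_
    refine intervalIntegral.integral_congr fun r hr => ?_
    rw [uIcc_of_le hs.1] at hr
    have hr' : r ∈ Icc 0 (δ / 2) := ⟨hr.1, hr.2.trans hs.2⟩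
    simp only [hcurve _ hx _ (hsub hr'), hone _ (Ico_subset_Icc_self (hsub hr')) _ hx.2, one_smul]

end IsBackwardFlow

end

/-! ### From flow boxes to the whole backward flow -/

section

/-- Continuous induction on `[0, ∞)`. -/
theorem forall_nonneg_of_propagation {P : ℝ → Prop} (h0 : P 0)
    (hstep : ∀ s₀, 0 ≤ s₀ → ∃ ε > 0, ∀ s₁, 0 ≤ s₁ → s₁ ≤ s₀ → s₀ - ε < s₁ → P s₁ →
      ∀ s, s₁ ≤ s → s < s₀ + ε → P s) : ∀ s, 0 ≤ s → P s := by
  by_contra! hcon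
  obtain ⟨b, hb0, hb⟩ := hcon
  let S : Set ℝ := {s | 0 ≤ s ∧ ¬ P s}
  have hbdd : BddBelow S := ⟨0, fun s hs => hs.1⟩
  have hne : S.Nonempty := ⟨b, hb0, hb⟩
  have hm0 : 0 ≤ sInf S := le_csInf hne fun s hs => hs.1
  obtain ⟨ε, hε, H⟩ := hstep (sInf S) hm0
  have hs₁ : ∃ s₁, 0 ≤ s₁ ∧ s₁ ≤ sInf S ∧ sInf S - ε < s₁ ∧ P s₁ := by
    rcases eq_or_lt_of_le hm0 with hm | hm
    · exact ⟨0, le_rfl, hm0, by linarith, h0⟩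
    · obtain ⟨s₁, h1, h2⟩ := exists_between (max_lt hm (sub_lt_self (sInf S) hε))
      refine ⟨s₁, (le_max_left _ _).trans h1.le, h2.le, (le_max_right _ _).trans_lt h1, ?_⟩
      by_contra hP
      exact absurd (csInf_le hbdd ⟨(le_max_left _ _).trans h1.le, hP⟩) (not_le.2 h2)
  obtain ⟨s₁, h1, h2, h3, h4⟩ := hs₁
  obtain ⟨s, hs, hlt⟩ := exists_lt_of_csInf_lt hne (lt_add_of_pos_right (sInf S) hε)
  exact hs.2 (H s₁ h1 h2 h3 h4 s (h2.trans (csInf_le hbdd hs)) hlt)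

theorem IsBackwardFlow.intervalIntegrable {E : Type*} [NormedAddCommGroup E] [NormedSpace ℝ E]
    {M : Type*} [TopologicalSpace M] [ChartedSpace E M] [IsManifold 𝓘(ℝ, E) ∞ M]
    {V : (x : M) → TangentSpace 𝓘(ℝ, E) x} {Φ : ℝ → M → M} (h : IsBackwardFlow V Φ)
    {g : M → ℝ} (hg : Continuous g) (x : M) {a b : ℝ} (ha : 0 ≤ a) (hb : 0 ≤ b) :
    IntervalIntegrable (fun r => g (Φ (-r) x)) MeasureTheory.volume a b :=
  ContinuousOn.intervalIntegrable <|
    hg.comp_continuousOn ((h.continuousOn_curve x).mono fun _ hr => (le_min ha hb).trans hr.1)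

variable {E : Type*} [NormedAddCommGroup E] [NormedSpace ℝ E] [FiniteDimensional ℝ E]
  {M : Type*} [TopologicalSpace M] [T2Space M] [ChartedSpace E M] [IsManifold 𝓘(ℝ, E) ∞ M]
  {V : (x : M) → TangentSpace 𝓘(ℝ, E) x} {Φ : ℝ → M → M}

namespace IsBackwardFlow

theorem comp_neg (h : IsBackwardFlow V Φ) {s₁ s : ℝ} (h1 : 0 ≤ s₁) (h2 : s₁ ≤ s) (x : M) :
    Φ (-(s - s₁)) (Φ (-s₁) x) = Φ (-s) x := by
  have := FiniteDimensional.complete ℝ E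
  rw [h.comp (by linarith) (by linarith)]
  congr 1
  ring

theorem integral_split (h : IsBackwardFlow V Φ) {g : M → ℝ} (hg : Continuous g) (x : M)
    {s₁ s : ℝ} (h1 : 0 ≤ s₁) (h2 : s₁ ≤ s) :
    ∫ r in (0 : ℝ)..s, g (Φ (-r) x) = (∫ r in (0 : ℝ)..s₁, g (Φ (-r) x)) +
      ∫ r in (0 : ℝ)..(s - s₁), g (Φ (-r) (Φ (-s₁) x)) := by
  rw [← intervalIntegral.integral_add_adjacent_intervals
    (h.intervalIntegrable hg x le_rfl h1) (h.intervalIntegrable hg x h1 (h1.trans h2))]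
  congr 1
  have := intervalIntegral.integral_comp_sub_right (a := s₁) (b := s)
    (fun r => g (Φ (-r) (Φ (-s₁) x))) s₁
  rw [sub_self] at this
  rw [← this]
  refine intervalIntegral.integral_congr fun r hr => ?_
  rw [uIcc_of_le h2] at hr
  simp only [h.comp_neg h1 hr.1]

/-- A flow box around `Φ (-s₀) x`, entered slightly before time `s₀`. -/
theorem exists_box_at (h : IsBackwardFlow V Φ) (x : M) {s₀ : ℝ} (hs₀ : 0 ≤ s₀) :
    ∃ ε > 0, ∀ s₁, 0 ≤ s₁ → s₁ ≤ s₀ → s₀ - ε < s₁ → ∃ N : Set M, IsOpen N ∧ Φ (-s₁) x ∈ N ∧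
      ContinuousOn (fun p : ℝ × M => Φ (-p.1) p.2) (Icc 0 (2 * ε) ×ˢ N) ∧
      (∀ s ∈ Icc 0 (2 * ε), ContMDiffOn 𝓘(ℝ, E) 𝓘(ℝ, E) ∞ (Φ (-s)) N) ∧
      ∀ g : M → ℝ, ContMDiff 𝓘(ℝ, E) 𝓘(ℝ, ℝ) ∞ g → ∀ s ∈ Icc 0 (2 * ε),
        ContMDiffOn 𝓘(ℝ, E) 𝓘(ℝ, ℝ) ∞ (fun x => ∫ r in (0 : ℝ)..s, g (Φ (-r) x)) N := by
  obtain ⟨N, hNo, hz, δ, hδ, hc, hs, hg⟩ := h.exists_box (Φ (-s₀) x)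
  have h1 := h.continuousOn_curve x s₀ hs₀ (hNo.mem_nhds hz)
  obtain ⟨ε, hε, H⟩ := Metric.mem_nhdsWithin_iff.1 (mem_map.1 h1)
  -- The factor `2` lets one box carry the flow from after `s₀ - ε` to before `s₀ + ε`.
  have hle : 2 * min ε (δ / 2) ≤ δ := by linarith [min_le_right ε (δ / 2)]
  have hsub : Icc 0 (2 * min ε (δ / 2)) ⊆ Icc 0 δ := Icc_subset_Icc_right hle
  refine ⟨min ε (δ / 2), by positivity, fun s₁ h0 h1 h2 => ⟨N, hNo, ?_, ?_, ?_, ?_⟩⟩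
  · refine H ⟨?_, h0⟩
    rw [Metric.mem_ball, Real.dist_eq, abs_lt]
    have := min_le_left ε (δ / 2)
    exact ⟨by linarith, by linarith⟩
  · exact hc.mono (prod_mono hsub subset_rfl)
  · exact fun s hs' => hs s (hsub hs')
  · exact fun g hg' s hs' => hg g hg' s (hsub hs')

/-- Continuous induction on `s`: the flow and the integral factor at an earlier time `s₁`, and the
remaining piece lies in one box. The two claims are propagated together because the rest of the
integral is composed with `Φ (-s₁)`. -/
theorem contMDiffAt_and_integral (h : IsBackwardFlow V Φ) (x : M) :
    ∀ s, 0 ≤ s → ContMDiffAt 𝓘(ℝ, E) 𝓘(ℝ, E) ∞ (Φ (-s)) x ∧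
      ∀ g : M → ℝ, ContMDiff 𝓘(ℝ, E) 𝓘(ℝ, ℝ) ∞ g →
        ContMDiffAt 𝓘(ℝ, E) 𝓘(ℝ, ℝ) ∞ (fun x => ∫ r in (0 : ℝ)..s, g (Φ (-r) x)) x := by
  apply forall_nonneg_of_propagation
  · refine ⟨?_, fun g hg => ?_⟩
    · have : Φ (-0) = id := funext fun y => by rw [neg_zero, h.zero, id]
      rw [this]
      exact contMDiffAt_id
    · simp only [intervalIntegral.integral_same]
      exact contMDiffAt_const
  · intro s₀ hs₀
    obtain ⟨ε, hε, H⟩ := h.exists_box_at x hs₀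
    refine ⟨ε, hε, fun s₁ h0 h1 h2 hP s hs hlt => ?_⟩
    obtain ⟨N, hNo, hxN, -, hN, hNg⟩ := H s₁ h0 h1 h2
    have hmem : s - s₁ ∈ Icc 0 (2 * ε) := ⟨by linarith, by linarith⟩
    refine ⟨?_, fun g hg => ?_⟩
    · have h3 := ((hN _ hmem).contMDiffAt (hNo.mem_nhds hxN)).comp x hP.1
      exact h3.congr_of_eventuallyEq (Eventually.of_forall fun y => (h.comp_neg h0 hs y).symm)
    · have h3 := ((hNg g hg _ hmem).contMDiffAt (hNo.mem_nhds hxN)).comp x hP.1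
      exact ((hP.2 g hg).add h3).congr_of_eventuallyEq
        (Eventually.of_forall fun y => h.integral_split hg.continuous y h0 hs)

theorem contMDiff (h : IsBackwardFlow V Φ) {s : ℝ} (hs : 0 ≤ s) :
    ContMDiff 𝓘(ℝ, E) 𝓘(ℝ, E) ∞ (Φ (-s)) := fun x => (h.contMDiffAt_and_integral x s hs).1

theorem contMDiff_integral (h : IsBackwardFlow V Φ) {s : ℝ} (hs : 0 ≤ s) {g : M → ℝ}
    (hg : ContMDiff 𝓘(ℝ, E) 𝓘(ℝ, ℝ) ∞ g) :
    ContMDiff 𝓘(ℝ, E) 𝓘(ℝ, ℝ) ∞ (fun x => ∫ r in (0 : ℝ)..s, g (Φ (-r) x)) :=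
  fun x => (h.contMDiffAt_and_integral x s hs).2 g hg

theorem continuousOn (h : IsBackwardFlow V Φ) :
    ContinuousOn (fun p : ℝ × M => Φ (-p.1) p.2) (Ici 0 ×ˢ univ) := by
  rintro ⟨s₀, x⟩ ⟨hs₀ : 0 ≤ s₀, -⟩
  obtain ⟨ε, hε, H⟩ := h.exists_box_at x hs₀
  obtain ⟨N, hNo, hxN, hN, -, -⟩ := H (max 0 (s₀ - ε / 2)) (le_max_left _ _)
    (max_le hs₀ (by linarith)) ((by linarith : s₀ - ε < s₀ - ε / 2).trans_le (le_max_right _ _))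
  -- Entering strictly before `s₀`, or at `0` if `s₀ = 0`, makes `[s₁, s₀ + ε)` a neighbourhood of
  -- `s₀` in `[0, ∞)`.
  set s₁ := max 0 (s₀ - ε / 2) with hs₁
  have h1 : 0 ≤ s₁ := le_max_left _ _
  have h2 : s₀ - ε / 2 ≤ s₁ := le_max_right _ _
  have h3 : s₁ ≤ s₀ := max_le hs₀ (by linarith)
  have hc := (h.contMDiff h1).continuous
  let W : Set (ℝ × M) := (Ici s₁ ∩ Iio (s₀ + ε)) ×ˢ (Φ (-s₁) ⁻¹' N)
  have hW : W ∈ 𝓝[Ici 0 ×ˢ univ] (s₀, x) := by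
    rw [nhdsWithin_prod_eq, nhdsWithin_univ]
    refine prod_mem_prod ?_ (hc.continuousAt.preimage_mem_nhds (hNo.mem_nhds hxN))
    refine mem_nhdsWithin.2 ⟨Ioo (s₀ - ε / 2) (s₀ + ε), isOpen_Ioo, ⟨by linarith, by linarith⟩, ?_⟩
    exact fun s hs => show s ∈ Ici s₁ ∩ Iio (s₀ + ε) from ⟨max_le hs.2 hs.1.1.le, hs.1.2⟩
  have h4 : ContinuousOn (fun p : ℝ × M => Φ (-(p.1 - s₁)) (Φ (-s₁) p.2)) W := by
    refine hN.comp (f := fun p : ℝ × M => (p.1 - s₁, Φ (-s₁) p.2)) (by fun_prop) ?_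
    rintro ⟨s, y⟩ ⟨⟨hs1, hs2⟩, hy⟩
    simp only [mem_Ici, mem_Iio] at hs1 hs2
    exact ⟨⟨by simpa using hs1, by simp only; linarith⟩, hy⟩
  have h5 : ContinuousOn (fun p : ℝ × M => Φ (-p.1) p.2) W :=
    h4.congr fun p hp => (h.comp_neg h1 hp.1.1 p.2).symm
  have h6 : ((s₀, x) : ℝ × M) ∈ W := mem_of_mem_nhdsWithin
    (show ((s₀, x) : ℝ × M) ∈ Ici (0 : ℝ) ×ˢ univ from ⟨hs₀, mem_univ x⟩) hW
  exact (h5 _ h6).mono_of_mem_nhdsWithin hW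

end IsBackwardFlow

end

/-! ### Slice charts along regular level sets -/

section

variable {E : Type*} [NormedAddCommGroup E] [NormedSpace ℝ E]
  {M : Type*} [TopologicalSpace M] [ChartedSpace E M]

theorem mem_contDiffGroupoid_of_contDiffOn {e : OpenPartialHomeomorph E E}
    (h : ContDiffOn ℝ ∞ e e.source) (h' : ContDiffOn ℝ ∞ e.symm e.target) :
    e ∈ contDiffGroupoid ∞ 𝓘(ℝ, E) := by
  rw [contDiffGroupoid, mem_groupoid_of_pregroupoid, contDiffPregroupoid]
  constructor <;> simpa

theorem chartAt_trans_mem_maximalAtlas [IsManifold 𝓘(ℝ, E) ∞ M] (x : M)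
    {e : OpenPartialHomeomorph E E} (he : e ∈ contDiffGroupoid ∞ 𝓘(ℝ, E)) :
    (chartAt E x).trans e ∈ IsManifold.maximalAtlas 𝓘(ℝ, E) ∞ M := by
  refine mem_maximalAtlas_iff.2 fun e' he' => ⟨?_, ?_⟩
  · rw [OpenPartialHomeomorph.trans_symm_eq_symm_trans_symm, OpenPartialHomeomorph.trans_assoc]
    exact StructureGroupoid.trans _ (StructureGroupoid.symm _ he)
      (HasGroupoid.compatible (chart_mem_atlas E x) he')
  · rw [← OpenPartialHomeomorph.trans_assoc]
    exact StructureGroupoid.trans _ (HasGroupoid.compatible he' (chart_mem_atlas E x)) he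

/-- A smooth function with nonzero derivative can be made affine by a local diffeomorphism whose
derivative at the given point is the identity. -/
theorem exists_straightening [CompleteSpace E] {h : E → ℝ} {s : Set E} (hs : IsOpen s)
    (hh : ContDiffOn ℝ ∞ h s) {u₀ : E} (hu₀ : u₀ ∈ s) (hd : fderiv ℝ h u₀ ≠ 0) :
    ∃ e : OpenPartialHomeomorph E E, e ∈ contDiffGroupoid ∞ 𝓘(ℝ, E) ∧ u₀ ∈ e.source ∧
      e.source ⊆ s ∧ HasFDerivAt e (ContinuousLinearMap.id ℝ E) u₀ ∧
      ∀ u ∈ e.source, fderiv ℝ h u₀ (e u) = h u := by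
  set ℓ := fderiv ℝ h u₀ with hℓ
  obtain ⟨v₁, hv₁⟩ : ∃ v, ℓ v ≠ 0 := by
    by_contra! hcon
    exact hd (ContinuousLinearMap.ext hcon)
  obtain ⟨v, hv⟩ : ∃ v, ℓ v = 1 := ⟨(ℓ v₁)⁻¹ • v₁, by simp [hv₁]⟩
  -- Since `ℓ v = 1`, `ℓ ∘ G = h`; the correction term has zero derivative at `u₀`, so `G` has
  -- identity derivative there.
  let G : E → E := fun u => u + (h u - ℓ u) • v
  have hGs : ContDiffOn ℝ ∞ G s :=
    contDiffOn_id.add ((hh.sub ℓ.contDiff.contDiffOn).smul contDiffOn_const)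
  have hG₀ : HasFDerivAt G (ContinuousLinearEquiv.refl ℝ E : E →L[ℝ] E) u₀ := by
    have h1 : HasFDerivAt h ℓ u₀ :=
      ((hh.contDiffAt (hs.mem_nhds hu₀)).differentiableAt (by simp)).hasFDerivAt
    have h2 := (hasFDerivAt_id u₀).add ((h1.sub ℓ.hasFDerivAt).smul_const v)
    convert! h2 using 1
    ext
    simp
  have hGu₀ : ContDiffAt ℝ ∞ G u₀ := hGs.contDiffAt (hs.mem_nhds hu₀)
  let e₁ := hGu₀.toOpenPartialHomeomorph G hG₀ (by simp)
  let inv : Set (E →L[ℝ] E) := range ((↑) : (E ≃L[ℝ] E) → E →L[ℝ] E)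
  have hinv : IsOpen inv := ContinuousLinearEquiv.isOpen
  -- On `S` the derivative is invertible at every point, so the inverse is smooth on the whole
  -- target.
  let S : Set E := s ∩ fderiv ℝ G ⁻¹' inv
  have hS : IsOpen S := (hGs.continuousOn_fderiv_of_isOpen hs (by simp)).isOpen_inter_preimage hs hinv
  refine ⟨e₁.restrOpen S hS, mem_contDiffGroupoid_of_contDiffOn ?_ ?_, ?_, ?_, hG₀, ?_⟩
  · exact hGs.mono fun u hu => hu.2.1
  · intro y hy
    have hmem := (e₁.restrOpen S hS).map_target hy
    obtain ⟨A, hA⟩ := hmem.2.2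
    have hsm : ContDiffAt ℝ ∞ G ((e₁.restrOpen S hS).symm y) :=
      hGs.contDiffAt (hs.mem_nhds hmem.2.1)
    refine ((e₁.restrOpen S hS).contDiffAt_symm (f₀' := A) hy ?_ hsm).contDiffWithinAt
    rw [hA]
    exact (hsm.differentiableAt (by simp)).hasFDerivAt
  · exact ⟨hGu₀.mem_toOpenPartialHomeomorph_source hG₀ (by simp), hu₀,
      ⟨ContinuousLinearEquiv.refl ℝ E, hG₀.fderiv.symm⟩⟩
  · exact fun u hu => hu.2.1
  · intro u _
    change ℓ (u + (h u - ℓ u) • v) = h u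
    simp [hv]

theorem hasMFDerivAt_of_eq {f : M → ℝ} {p q : M} (h : p = q) {df : E →L[ℝ] ℝ}
    (hf : HasMFDerivAt 𝓘(ℝ, E) 𝓘(ℝ, ℝ) f p df) : HasMFDerivAt 𝓘(ℝ, E) 𝓘(ℝ, ℝ) f q df := by
  subst h
  exact hf

/-- A regular sublevel set has slice charts along its boundary, and vectors along which the
defining function increases point outward. -/
theorem exists_isBoundarySliceChart [CompleteSpace E] [IsManifold 𝓘(ℝ, E) ∞ M] {f : M → ℝ}
    (hf : ContMDiff 𝓘(ℝ, E) 𝓘(ℝ, ℝ) ∞ f) {x : M} {v : TangentSpace 𝓘(ℝ, E) x}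
    {df : E →L[ℝ] ℝ} (hdf : HasMFDerivAt 𝓘(ℝ, E) 𝓘(ℝ, ℝ) f x df) (hv : 0 < df v) :
    ∃ (e : OpenPartialHomeomorph M E) (ℓ : E →L[ℝ] ℝ),
      IsBoundarySliceChart {y | f y ≤ f x} x e ℓ ∧
        0 < ℓ (mfderiv 𝓘(ℝ, E) 𝓘(ℝ, E) e x v) := by
  set φ := extChartAt 𝓘(ℝ, E) x with hφ
  have hfφ : ContDiffOn ℝ ∞ (f ∘ φ.symm) φ.target :=
    (hf.comp_contMDiffOn (contMDiffOn_extChartAt_symm x)).contDiffOn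
  have hto : IsOpen φ.target := isOpen_extChartAt_target x
  have hxt : φ x ∈ φ.target := mem_extChartAt_target x
  have hℓ : fderiv ℝ (f ∘ φ.symm) (φ x) = df := by
    have h1 := ((contMDiffAt_extChartAt_symm' x hxt).mdifferentiableAt (by simp)).hasMFDerivAt
    have h2 : mfderiv 𝓘(ℝ, E) 𝓘(ℝ, E) φ.symm (φ x) = ContinuousLinearMap.id ℝ E := by
      have := mfderivWithin_range_extChartAt_symm (I := 𝓘(ℝ, E)) (x := x)
      rwa [modelWithCornersSelf_coe, Set.range_id, mfderivWithin_univ] at this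
    rw [h2] at h1
    have h3 := (hasMFDerivAt_of_eq (extChartAt_to_inv (I := 𝓘(ℝ, E)) x).symm hdf).comp (φ x) h1
    have h4 : HasFDerivAt (f ∘ φ.symm) df (φ x) := hasMFDerivAt_iff_hasFDerivAt.1 h3
    exact h4.fderiv
  have hd : fderiv ℝ (f ∘ φ.symm) (φ x) ≠ 0 := by
    rw [hℓ]
    rintro rfl
    exact lt_irrefl (0 : ℝ) hv
  obtain ⟨e, he, hxe, hes, hed, heq⟩ := exists_straightening hto hfφ hxt hd
  rw [hℓ] at heq hd
  have hval : ∀ y ∈ ((chartAt E x).trans e).source, df (((chartAt E x).trans e) y) = f y := by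
    intro y hy
    have h1 := heq _ hy.2
    refine h1.trans (congrArg f (φ.left_inv ?_))
    rw [hφ, extChartAt_source]
    exact hy.1
  have hxs : x ∈ ((chartAt E x).trans e).source := ⟨mem_chart_source E x, hxe⟩
  refine ⟨(chartAt E x).trans e, df, ⟨chartAt_trans_mem_maximalAtlas x he, hxs, hd, ?_⟩, ?_⟩
  · intro y hy
    rw [hval y hy, hval x hxs]
    rfl
  · have h1 := (mdifferentiableAt_extChartAt (I := 𝓘(ℝ, E)) (mem_chart_source E x)).hasMFDerivAt
    rw [mfderiv_extChartAt_self] at h1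
    have h2 := (HasMFDerivAt.comp x hed.hasMFDerivAt h1).mfderiv
    have h3 : @Eq E (mfderiv 𝓘(ℝ, E) 𝓘(ℝ, E) ((chartAt E x).trans e) x v) v :=
      DFunLike.congr_fun h2 v
    exact hv.trans_eq (congrArg df h3).symm

end

/-! ### Topology of sublevel sets -/

/-- Flowing until a sublevel set is reached is a deformation retraction onto that set, for a
continuous semiflow along which the function decreases, strictly at the boundary level. -/
theorem isDeformationRetract_sublevel {Y : Type*} [TopologicalSpace Y] {Ψ : ℝ → Y → Y}
    {f : Y → ℝ} {c : ℝ} (hΨ : ContinuousOn (fun p : ℝ × Y => Ψ p.1 p.2) (Ici 0 ×ˢ univ))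
    (h0 : ∀ y, Ψ 0 y = y)
    (hadd : ∀ s₁ s, 0 ≤ s₁ → s₁ ≤ s → ∀ y, Ψ (s - s₁) (Ψ s₁ y) = Ψ s y)
    (hf : Continuous f) (hanti : ∀ y s, 0 ≤ s → f (Ψ s y) ≤ f y)
    (hstrict : ∀ y s, 0 < s → f y = c → f (Ψ s y) < c) (habs : ∀ y, f (Ψ 1 y) ≤ c) :
    IsDeformationRetract {y | f y ≤ c} := by
  let S : Y → Set ℝ := fun y => Ici 0 ∩ (fun t => f (Ψ t y)) ⁻¹' Iic c
  -- The hitting time of the sublevel set. The homotopy follows the orbit of `y` up to time `s * τ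
  -- y`.
  let τ : Y → ℝ := fun y => sInf (S y)
  have hS1 (y : Y) : (1 : ℝ) ∈ S y := ⟨mem_Ici.2 zero_le_one, habs y⟩
  have hbdd (y : Y) : BddBelow (S y) := ⟨0, fun t ht => ht.1⟩
  have horbit (y : Y) : ContinuousOn (fun t => Ψ t y) (Ici 0) :=
    hΨ.comp (Continuous.prodMk_left y).continuousOn fun t ht => ⟨ht, mem_univ _⟩
  have hslice {t : ℝ} (ht : 0 ≤ t) : Continuous (Ψ t) := by
    have : ContinuousOn (fun y => Ψ t y) univ :=
      hΨ.comp (Continuous.prodMk_right t).continuousOn fun y _ => ⟨ht, mem_univ _⟩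
    exact continuousOn_univ.1 this
  have hτS (y : Y) : τ y ∈ S y :=
    ((hf.comp_continuousOn (horbit y)).preimage_isClosed_of_isClosed isClosed_Ici
      isClosed_Iic).csInf_mem ⟨1, hS1 y⟩ (hbdd y)
  have hτ0 (y : Y) : 0 ≤ τ y := (hτS y).1
  have hτle {y : Y} {t : ℝ} (ht : 0 ≤ t) (h : f (Ψ t y) ≤ c) : τ y ≤ t :=
    csInf_le (hbdd y) ⟨ht, h⟩
  have hτX {y : Y} (hy : f y ≤ c) : τ y = 0 :=
    le_antisymm (hτle le_rfl (by rwa [h0])) (hτ0 y)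
  have hlt {y : Y} {t : ℝ} (ht : τ y < t) : f (Ψ t y) < c := by
    rw [← hadd (τ y) t (hτ0 y) ht.le y]
    rcases (show f (Ψ (τ y) y) ≤ c from (hτS y).2).lt_or_eq with h | h
    · exact (hanti _ _ (sub_nonneg.2 ht.le)).trans_lt h
    · exact hstrict _ _ (sub_pos.2 ht) h
  have hgt {y : Y} {t : ℝ} (h0t : 0 ≤ t) (ht : t < τ y) : c < f (Ψ t y) := by
    by_contra! h
    exact absurd (hτle h0t h) (not_le.2 ht)
  have hτc : Continuous τ := by
    -- Before the hitting time `f` exceeds `c` and after it `f` is below `c`, both strictly; these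
    -- open conditions persist for nearby starting points.
    refine continuous_iff_continuousAt.2 fun y => tendsto_order.2 ⟨fun a ha => ?_, fun b hb => ?_⟩
    · rcases lt_or_ge a 0 with ha0 | ha0
      · exact Eventually.of_forall fun z => ha0.trans_le (hτ0 z)
      · filter_upwards [(hf.comp (hslice ha0)).continuousAt.eventually (lt_mem_nhds (hgt ha0 ha))]
          with z hz
        by_contra! hle
        rcases hle.lt_or_eq with h | h
        · exact absurd (hlt h) (not_lt.2 (le_of_lt hz))
        · exact absurd (show f (Ψ (τ z) z) ≤ c from (hτS z).2) (by rw [h]; exact not_le.2 hz)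
    · obtain ⟨t, ht, htb⟩ := exists_between hb
      have ht0 : 0 ≤ t := (hτ0 y).trans ht.le
      filter_upwards [(hf.comp (hslice ht0)).continuousAt.eventually (gt_mem_nhds (hlt ht))]
        with z hz
      exact (hτle ht0 (le_of_lt hz)).trans_lt htb
  have hH : Continuous fun p : unitInterval × Y => Ψ ((p.1 : ℝ) * τ p.2) p.2 := by
    refine hΨ.comp_continuous (f := fun p : unitInterval × Y => ((p.1 : ℝ) * τ p.2, p.2))
      (by fun_prop) fun p => ⟨mul_nonneg p.1.2.1 (hτ0 _), mem_univ _⟩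
  refine ⟨⟨fun y => Ψ (τ y) y, ?_⟩, fun y => (hτS y).2, ⟨⟨⟨⟨_, hH⟩, ?_, ?_⟩, ?_⟩⟩⟩
  · exact hΨ.comp_continuous (f := fun y => (τ y, y)) (by fun_prop)
      fun y => ⟨hτ0 y, mem_univ _⟩
  · intro y
    simp [h0]
  · intro y
    simp
  · intro t y hy
    simp [hτX hy, h0]

/-- A sublevel set is contained in `B` if the value is exceeded on the frontier of `B` and each
point can be joined to the interior of `B` by a path along which the function does not exceed its
initial value. -/
theorem sublevel_subset_of_lt_frontier {Y : Type*} [TopologicalSpace Y] {B : Set Y} {f : Y → ℝ}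
    {c : ℝ} (hc : ∀ y ∈ frontier B, c < f y)
    (hpath : ∀ y, ∃ P : Set Y, IsPreconnected P ∧ y ∈ P ∧ (∀ z ∈ P, f z ≤ f y) ∧
      (P ∩ interior B).Nonempty) : {y | f y ≤ c} ⊆ closure B := by
  intro y hy
  by_contra hyB
  obtain ⟨P, hP, hyP, hle, hPB⟩ := hpath y
  obtain ⟨z, -, hz1, hz2⟩ := hP (interior B) (closure B)ᶜ isOpen_interior
    isClosed_closure.isOpen_compl
    (fun z hz => by
      by_contra hcon
      simp only [mem_union, not_or, mem_compl_iff, not_not] at hcon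
      exact absurd (hc z ⟨hcon.2, hcon.1⟩) (not_lt.2 ((hle z hz).trans hy)))
    hPB ⟨y, hyP, hyB⟩
  exact hz2 (subset_closure (interior_subset hz1))

/-- A continuous function that is positive on a compact set exceeds a positive constant there. -/
theorem exists_pos_forall_lt_of_isCompact {Y : Type*} [TopologicalSpace Y] {C : Set Y}
    (hC : IsCompact C) {f : Y → ℝ} (hf : Continuous f) (hpos : ∀ y ∈ C, 0 < f y) :
    ∃ c > 0, ∀ y ∈ C, c < f y := by
  rcases C.eq_empty_or_nonempty with rfl | hne
  · exact ⟨1, one_pos, by simp⟩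
  · obtain ⟨y₀, hy₀, hmin⟩ := hC.exists_isMinOn hne hf.continuousOn
    exact ⟨f y₀ / 2, half_pos (hpos _ hy₀),
      fun y hy => (half_lt_self (hpos _ hy₀)).trans_le (hmin hy)⟩

/-! ### The orbit integral and the choice of the sublevel set -/

section

variable {E : Type*} [NormedAddCommGroup E] [NormedSpace ℝ E] [FiniteDimensional ℝ E]
  {M : Type*} [TopologicalSpace M] [T2Space M] [ChartedSpace E M] [IsManifold 𝓘(ℝ, E) ∞ M]
  {V : (x : M) → TangentSpace 𝓘(ℝ, E) x} {Φ : ℝ → M → M}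

/-- The integral of `g` over the backward orbit segment of length one from `x`. -/
def orbitIntegral (Φ : ℝ → M → M) (g : M → ℝ) (x : M) : ℝ := ∫ r in (0 : ℝ)..1, g (Φ (-r) x)

/-- If `g` vanishes once the orbit has been followed for unit time, the orbit integral changes
along a backward orbit by the integral of `-g`. -/
theorem IsBackwardFlow.orbitIntegral_apply (h : IsBackwardFlow V Φ) {g : M → ℝ}
    (hg : Continuous g) (hg1 : ∀ x s, 1 ≤ s → g (Φ (-s) x) = 0) (x : M) {s : ℝ} (hs : 0 ≤ s) :
    orbitIntegral Φ g (Φ (-s) x) = orbitIntegral Φ g x - ∫ r in (0 : ℝ)..s, g (Φ (-r) x) := by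
  -- The integral over `[0, s + 1]` is split at `s` and at `1`; in the second splitting the tail
  -- vanishes.
  have h1 := h.integral_split hg x hs (le_add_of_nonneg_right zero_le_one : s ≤ s + 1)
  have h2 := h.integral_split hg x zero_le_one (le_add_of_nonneg_left hs : 1 ≤ s + 1)
  have h3 : ∫ r in (0 : ℝ)..(s + 1 - 1), g (Φ (-r) (Φ (-1) x)) = 0 := by
    rw [intervalIntegral.integral_congr (g := fun _ => (0 : ℝ))]
    · simp
    · intro r hr
      rw [uIcc_of_le (by linarith)] at hr
      have := h.comp_neg zero_le_one (le_add_of_nonneg_left hr.1 : 1 ≤ r + 1) x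
      rw [add_sub_cancel_right] at this
      beta_reduce
      rw [this]
      exact hg1 x _ (le_add_of_nonneg_left hr.1)
  rw [add_sub_cancel_left] at h1
  rw [orbitIntegral, orbitIntegral]
  linarith

/-- The derivative of the orbit integral along the vector field is `g`. -/
theorem IsBackwardFlow.exists_hasMFDerivAt_orbitIntegral (h : IsBackwardFlow V Φ) {g : M → ℝ}
    (hg : ContMDiff 𝓘(ℝ, E) 𝓘(ℝ, ℝ) ∞ g) (hg1 : ∀ x s, 1 ≤ s → g (Φ (-s) x) = 0) (x : M) :
    ∃ df : E →L[ℝ] ℝ, HasMFDerivAt 𝓘(ℝ, E) 𝓘(ℝ, ℝ) (orbitIntegral Φ g) x df ∧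
      df (V x) = g x := by
  have hf : ContMDiff 𝓘(ℝ, E) 𝓘(ℝ, ℝ) ∞ (orbitIntegral Φ g) :=
    h.contMDiff_integral zero_le_one hg
  have hd := ((hf x).mdifferentiableAt (by simp)).hasMFDerivAt
  refine ⟨mfderiv 𝓘(ℝ, E) 𝓘(ℝ, ℝ) (orbitIntegral Φ g) x, hd, ?_⟩
  -- The derivative of `f (Φ t x)` at `t = 0` within `t ≤ 0` is computed by the chain rule and by
  -- the explicit formula. One side suffices, as derivatives within a half-line are unique.
  have hγ := h.integralCurve x 0 self_mem_Iic
  have hcomp := HasMFDerivAt.comp_hasMFDerivWithinAt (g := orbitIntegral Φ g) (0 : ℝ)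
    (((hf (Φ 0 x)).mdifferentiableAt (by simp)).hasMFDerivAt) hγ
  let D : E →L[ℝ] ℝ := mfderiv 𝓘(ℝ, E) 𝓘(ℝ, ℝ) (orbitIntegral Φ g) (Φ 0 x)
  let v : E := V (Φ 0 x)
  have hF : HasFDerivWithinAt (fun t => orbitIntegral Φ g (Φ t x))
      (D.comp ((1 : ℝ →L[ℝ] ℝ).smulRight v)) (Iic 0) 0 :=
    hasMFDerivWithinAt_iff_hasFDerivWithinAt.1 hcomp
  have hA : HasDerivWithinAt (fun t => orbitIntegral Φ g (Φ t x)) (D v) (Iic 0) 0 := by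
    have := hF.hasDerivWithinAt
    rwa [show (D.comp ((1 : ℝ →L[ℝ] ℝ).smulRight v)) 1 = D v by simp] at this
  have hB : HasDerivWithinAt (fun t => orbitIntegral Φ g (Φ t x)) (g x) (Iic 0) 0 := by
    -- Truncation at `0` gives a continuous integrand on the whole line, since `Φ` is uncontrolled
    -- at positive times.
    have hk : Continuous fun r : ℝ => g (Φ (-(max r 0)) x) := by
      have : Continuous fun r : ℝ => Φ (-(max r 0)) x :=
        (h.continuousOn_curve x).comp_continuous (f := fun r : ℝ => max r 0) (by fun_prop)
          fun r => le_max_right r 0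
      exact hg.continuous.comp this
    have h1 := (hk.integral_hasStrictDerivAt 0 (-0)).hasDerivAt
    have h2 := (h1.comp (0 : ℝ) (hasDerivAt_neg (0 : ℝ))).const_sub (orbitIntegral Φ g x)
    have h3 := h2.hasDerivWithinAt (s := Iic (0 : ℝ))
    have h4 : -(g (Φ (-(max (-0) 0)) x) * -1) = g x := by simp [h.zero]
    rw [h4] at h3
    refine h3.congr_of_mem (fun t ht => ?_) self_mem_Iic
    have h5 := h.orbitIntegral_apply hg.continuous hg1 x (neg_nonneg.2 ht)
    rw [neg_neg] at h5
    rw [h5]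
    congr 1
    refine intervalIntegral.integral_congr (g := fun r => g (Φ (-(max r 0)) x)) fun r hr => ?_
    rw [uIcc_of_le (neg_nonneg.2 ht)] at hr
    simp [max_eq_left hr.1]
  have hv : D v = g x := (uniqueDiffOn_Iic (0 : ℝ) 0 self_mem_Iic).eq_deriv (Iic 0) hA hB
  have key : ∀ y (_ : y = x), @DFunLike.coe (E →L[ℝ] ℝ) E (fun _ => ℝ) _
      (mfderiv 𝓘(ℝ, E) 𝓘(ℝ, ℝ) (orbitIntegral Φ g) y) (V y) = g x →
      @DFunLike.coe (E →L[ℝ] ℝ) E (fun _ => ℝ) _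
      (mfderiv 𝓘(ℝ, E) 𝓘(ℝ, ℝ) (orbitIntegral Φ g) x) (V x) = g x := by
    rintro y rfl hy
    exact hy
  exact key _ (h.zero x) hv

/-- If all of the manifold flows into a compact set in negative time, every compact set lies in a
compact set that is preserved by the backward flow and absorbs the manifold in unit time. -/
theorem IsBackwardFlow.exists_isCompact_absorbing (h : IsBackwardFlow V Φ)
    (hΦ : IsCompact (closure (range (Φ (-1))))) {K : Set M} (hK : IsCompact K) :
    ∃ A, IsCompact A ∧ K ⊆ A ∧ (∀ x ∈ A, ∀ s, 0 ≤ s → Φ (-s) x ∈ A) ∧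
      ∀ x s, 1 ≤ s → Φ (-s) x ∈ A := by
  let C := K ∪ closure (range (Φ (-1)))
  -- Unit-length orbit segments suffice for invariance: past time `1` every orbit is in the range of
  -- `Φ (-1)`, hence in `C`.
  let A := (fun p : ℝ × M => Φ (-p.1) p.2) '' (Icc 0 1 ×ˢ C)
  have hmem {x : M} (hx : x ∈ C) : x ∈ A :=
    ⟨(0, x), ⟨left_mem_Icc.2 zero_le_one, hx⟩, by simp [h.zero]⟩
  have habs (x : M) (s : ℝ) (hs : 1 ≤ s) : Φ (-s) x ∈ A := by
    refine hmem (Or.inr (subset_closure ⟨Φ (-(s - 1)) x, ?_⟩))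
    have := h.comp_neg (sub_nonneg.2 hs) (sub_le_self s zero_le_one) x
    rwa [sub_sub_cancel] at this
  refine ⟨A, ?_, fun x hx => hmem (Or.inl hx), ?_, habs⟩
  · exact (isCompact_Icc.prod (hK.union hΦ)).image_of_continuousOn
      (h.continuousOn.mono fun p hp => ⟨hp.1.1, mem_univ _⟩)
  · rintro _ ⟨⟨t, x⟩, ⟨ht, hx⟩, rfl⟩ s hs
    have := h.comp_neg ht.1 (le_add_of_nonneg_left hs) x
    rw [add_sub_cancel_right] at this
    beta_reduce
    rw [this]
    rcases le_or_gt (s + t) 1 with h1 | h1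
    · exact ⟨(s + t, x), ⟨⟨add_nonneg hs ht.1, h1⟩, hx⟩, rfl⟩
    · exact habs x _ h1.le

/-- Every compact set lies in a regular sublevel set which is compact, onto which the manifold
retracts, and along whose boundary the vector field points outward. -/
theorem IsBackwardFlow.exists_sublevel [SecondCountableTopology M] (h : IsBackwardFlow V Φ)
    (hΦ : IsCompact (closure (range (Φ (-1))))) {K : Set M} (hK : IsCompact K) :
    ∃ f : M → ℝ, ∃ c, ContMDiff 𝓘(ℝ, E) 𝓘(ℝ, ℝ) ∞ f ∧ IsCompact {x | f x ≤ c} ∧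
      K ⊆ {x | f x ≤ c} ∧ IsDeformationRetract {x | f x ≤ c} ∧
      ∀ x, f x = c → ∃ df : E →L[ℝ] ℝ, HasMFDerivAt 𝓘(ℝ, E) 𝓘(ℝ, ℝ) f x df ∧ 0 < df (V x) := by
  have : LocallyCompactSpace M := Manifold.locallyCompact_of_finiteDimensional (M := M) 𝓘(ℝ, E)
  obtain ⟨A, hA, hKA, hinv, habs⟩ := h.exists_isCompact_absorbing hΦ hK
  obtain ⟨g, hgA, hg, hg0⟩ :=
    hA.isClosed.isOpen_compl.exists_contMDiff_support_eq (n := ⊤) 𝓘(ℝ, E)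
  have hgA0 {x : M} (hx : x ∈ A) : g x = 0 := by
    by_contra hne
    exact (hgA ▸ (Function.mem_support.2 hne) : x ∈ Aᶜ) hx
  have hgpos {x : M} (hx : x ∉ A) : 0 < g x :=
    (hg0 x).lt_of_ne' (Function.mem_support.1 (hgA.symm ▸ hx : x ∈ Function.support g))
  have hg1 (x : M) (s : ℝ) (hs : 1 ≤ s) : g (Φ (-s) x) = 0 := hgA0 (habs x s hs)
  let f := orbitIntegral Φ g
  have hf : ContMDiff 𝓘(ℝ, E) 𝓘(ℝ, ℝ) ∞ f := h.contMDiff_integral zero_le_one hg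
  have hpos {x : M} (hx : x ∉ A) {s : ℝ} (hs : 0 < s) :
      0 < ∫ r in (0 : ℝ)..s, g (Φ (-r) x) := by
    refine intervalIntegral.integral_pos hs
      (hg.continuous.comp_continuousOn ((h.continuousOn_curve x).mono fun _ hr => hr.1))
      (fun r _ => hg0 _) ⟨0, left_mem_Icc.2 hs.le, ?_⟩
    simpa [h.zero] using hgpos hx
  have hfA {x : M} (hx : x ∈ A) : f x = 0 := by
    refine (intervalIntegral.integral_congr (g := fun _ => (0 : ℝ)) fun r hr => ?_).trans (by simp)
    rw [uIcc_of_le zero_le_one] at hr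
    exact hgA0 (hinv x hx r hr.1)
  have hanti (x : M) (s : ℝ) (hs : 0 ≤ s) : f (Φ (-s) x) ≤ f x := by
    rw [show f (Φ (-s) x) = _ from h.orbitIntegral_apply hg.continuous hg1 x hs]
    exact sub_le_self _ (intervalIntegral.integral_nonneg hs fun r _ => hg0 _)
  -- `A` lies in the interior of `B`, so `f` is positive on the compact frontier of `B` and a level
  -- `c > 0` fits below it.
  obtain ⟨B, hB, hAB⟩ := exists_compact_superset hA
  obtain ⟨c, hc, hcB⟩ := exists_pos_forall_lt_of_isCompact
    (hB.of_isClosed_subset isClosed_frontier hB.isClosed.frontier_subset) hf.continuous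
    fun y hy => hpos (fun hyA => hy.2 (hAB hyA)) one_pos
  have hcA {x : M} (hx : f x = c) : x ∉ A := fun hxA => hc.ne' (hx.symm.trans (hfA hxA))
  refine ⟨f, c, hf, ?_, fun x hx => (hfA (hKA hx)).trans_le hc.le, ?_, fun x hx => ?_⟩
  · refine hB.of_isClosed_subset (isClosed_le hf.continuous continuous_const)
      ((sublevel_subset_of_lt_frontier hcB fun y => ?_).trans hB.isClosed.closure_eq.subset)
    refine ⟨(fun s => Φ (-s) y) '' Icc 0 1, isPreconnected_Icc.image _
      ((h.continuousOn_curve y).mono fun _ hr => hr.1),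
      ⟨0, left_mem_Icc.2 zero_le_one, by simp [h.zero]⟩, ?_,
      ⟨_, ⟨1, right_mem_Icc.2 zero_le_one, rfl⟩, hAB (habs y 1 le_rfl)⟩⟩
    rintro _ ⟨s, hs, rfl⟩
    exact hanti y s hs.1
  · refine isDeformationRetract_sublevel (Ψ := fun s => Φ (-s)) h.continuousOn
      (fun y => by simp [h.zero]) (fun s₁ s h1 h2 y => h.comp_neg h1 h2 y) hf.continuous hanti
      (fun y s hs hy => ?_) fun y => (hfA (habs y 1 le_rfl)).trans_le hc.le
    rw [show f (Φ (-s) y) = _ from h.orbitIntegral_apply hg.continuous hg1 y hs.le]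
    exact (sub_lt_self _ (hpos (hcA hy) hs)).trans_eq hy
  · obtain ⟨df, hdf, hdfV⟩ := h.exists_hasMFDerivAt_orbitIntegral hg hg1 x
    exact ⟨df, hdf, hdfV ▸ hgpos (hcA hx)⟩

end

end Liouville

end

theorem proposition2p4 {E : Type*} [NormedAddCommGroup E] [NormedSpace ℝ E]
    [FiniteDimensional ℝ E] {M : Type*} [TopologicalSpace M] [T2Space M]
    [SecondCountableTopology M] [ChartedSpace E M] [IsManifold 𝓘(ℝ, E) ∞ M]
    (lam : Liouville.OneForm E M) (hlam : Liouville.IsOpenLiouvilleDomain lam) :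
    Liouville.IsTamelyExhausted lam := by
  obtain ⟨hs, Φ, h0, hcurve, hcpt⟩ := hlam
  have h : Liouville.IsBackwardFlow (Liouville.liouvilleField lam) Φ :=
    ⟨Liouville.contMDiff_liouvilleField hs, h0, hcurve⟩
  have := FiniteDimensional.complete ℝ E
  refine ⟨hs, fun K hK => ?_⟩
  -- Compactness of the closure of the image is needed only at time `-1`.
  obtain ⟨f, c, hf, hX, hKX, hret, hout⟩ := h.exists_sublevel (hcpt (-1) (by norm_num)) hK
  refine ⟨{x | f x ≤ c}, hX.isClosed, ⟨hs, hX, fun x hx => ?_⟩, hKX, hret⟩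
  rcases (show f x ≤ c from hx).lt_or_eq with hlt | rfl
  · exact Or.inl (interior_maximal (fun y hy => le_of_lt hy)
      (isOpen_lt hf.continuous continuous_const) hlt)
  · obtain ⟨df, hdf, hpos⟩ := hout x rfl
    exact Or.inr (Liouville.exists_isBoundarySliceChart hf hdf hpos)
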